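/- A (single-source single-sink, unit-demand) bottleneck routing game with identical arc costs is given by a finite directed graph $\mathcal D=(V,A)$ (parallel arcs allowed), vertices $s\neq t$ such that $t$ is reachable from $s$, a set $N=\{1,\dots,n\}$ of $n\ge 1$ players, and a non-decreasing function $c:\mathbb R_{\ge 0}\to\mathbb R_{\ge 0}$. Every player $i$ chooses a directed $s$-$t$ path $x_i$. For a strategy profile $x=(x_1,\dots,x_n)$ let $n_a(x)=|\{i : a\in x_i\}|$ be the load of the arc $a$; the private cost of player $i$ is the cost of the most expensive arc on her path, $\pi_i(x)=\max_{a\in x_i}c(n_a(x))$. A profile $x$ is a strong Nash equilibrium (SNE) if there are no nonempty coalition $S\subseteq N$ and no profile $y$ with $y_i=x_i$ for all $i\notin S$ and $\pi_i(y)<\pi_i(x)$ for all $i\in S$. Theorem. There is an algorithm (a program for a random access machine with addition and truncated subtraction, at unit cost per operation) which, given $\mathcal D$, $s$, $t$ and $n$, outputs after a number of steps polynomial in $|V|+|A|+n$ a strategy profile $x$ (listing the path of each of the $n$ players) such that (1) $x$ is an SNE of the game for every non-decreasing cost function $c:\mathbb R_{\ge 0}\to\mathbb R_{\ge 0}$;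 and (2) $x$ spreads the players evenly over the paths of a maximum flow: if $m$ is the minimum number of arcs in an $(s,t)$-cut of $\mathcal D$, there are $m$ pairwise arc-disjoint $s$-$t$ paths $P_1,\dots,P_m$ such that every player is routed along one of them and each $P_j$ is assigned $\lfloor n/m\rfloor$ or $\lceil n/m\rceil$ players. -/

import Mathlib

open scoped NNReal

/-! ## Strategic games -/

/-- Strong Nash equilibrium of a cost minimisation game with strategy sets `X i` and private
costs `π`: no nonempty coalition `S` has a joint deviation that strictly decreases the private
cost of each of its members. -/
def IsStrongNash {N : Type*} {X : N → Type*} (π : (∀ i, X i) → N → ℝ≥0) (x : ∀ i, X i) : Prop :=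
  ¬ ∃ S : Set N, S.Nonempty ∧ ∃ y : ∀ i, X i,
    (∀ i, i ∉ S → y i = x i) ∧ ∀ i ∈ S, π y i < π x i

/-! ## Directed graphs, paths and cuts -/

/-- A directed graph with vertex set `V` and arc set `A` (parallel arcs and loops allowed). -/
structure DirGraph (V A : Type*) where
  tail : A → V
  head : A → V

namespace DirGraph

variable {V A : Type*} (D : DirGraph V A)

/-- The list `p` of arcs is a directed walk from `u` to `v`. -/
def IsWalk (u : V) (p : List A) (v : V) : Prop :=
  match p with
  | [] => u = v
  | a :: q => D.tail a = u ∧ IsWalk (D.head a) q v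

/-- The list `p` of arcs is a directed path from `u` to `v`: a walk that repeats no vertex. -/
def IsPath (u : V) (p : List A) (v : V) : Prop :=
  D.IsWalk u p v ∧ (u :: p.map D.head).Nodup

/-- The directed paths from `u` to `v`. -/
abbrev PathFromTo (u v : V) := {p : List A // D.IsPath u p v}

/-- The arcs that leave the vertex set `U`. -/
def outArcs (U : Set V) : Set A := {a | D.tail a ∈ U ∧ D.head a ∉ U}

/-- `U` induces a minimum `(s,t)`-cut: `s ∈ U`, `t ∉ U`, and the number of arcs leaving `U`
is the smallest possible (all arcs have capacity one). -/
def IsMinCut (s t : V) (U : Set V) : Prop :=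
  s ∈ U ∧ t ∉ U ∧
    ∀ W : Set V, s ∈ W → t ∉ W → (D.outArcs U).ncard ≤ (D.outArcs W).ncard

/-- The `n` paths `x i` are spread evenly over `m` pairwise arc-disjoint `(s,t)`-paths, where `m`
is the capacity of a minimum `(s,t)`-cut (so that sending one unit along each of the `m` paths is
a maximum flow for unit capacities). -/
def IsEvenSpread (s t : V) {n : ℕ} (x : Fin n → D.PathFromTo s t) : Prop :=
  ∃ (m : ℕ) (P : Fin m → D.PathFromTo s t),
    (∃ U : Set V, D.IsMinCut s t U ∧ (D.outArcs U).ncard = m) ∧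
    (∀ j l, j ≠ l → List.Disjoint (P j).1 (P l).1) ∧
    ∃ φ : Fin n → Fin m, (∀ i, x i = P (φ i)) ∧
      ∀ j, {i | φ i = j}.ncard = n / m ∨ {i | φ i = j}.ncard = n ⌈/⌉ m

end DirGraph

/-! ## Bottleneck routing games -/

/-- A bottleneck routing game with set of players `N` on a directed graph: player `i` routes her
demand along one path from `src i` to `snk i`; arcs have non-negative non-decreasing costs that
depend on the load. -/
structure BottleneckRoutingGame (N V A : Type*) where
  graph : DirGraph V A
  src : N → V
  snk : N → V
  demand : N → ℝ≥0
  demand_pos : ∀ i, 0 < demand i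
  cost : A → ℝ≥0 → ℝ≥0
  cost_mono : ∀ a, Monotone (cost a)

namespace BottleneckRoutingGame

variable {N V A : Type*} (G : BottleneckRoutingGame N V A)

/-- The strategies of player `i`. -/
abbrev Strategy (i : N) := G.graph.PathFromTo (G.src i) (G.snk i)

/-- The load of arc `a`: the total demand of the players whose path contains `a`. -/
def load [Fintype N] [DecidableEq A] (x : ∀ i, G.Strategy i) (a : A) : ℝ≥0 :=
  ∑ i, if a ∈ (x i).1 then G.demand i else 0

/-- The private cost of player `i`: the maximum arc cost along her path. -/
def privateCost [Fintype N] [DecidableEq A] (x : ∀ i, G.Strategy i) (i : N) : ℝ≥0 :=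
  (x i).1.toFinset.sup fun a => G.cost a (G.load x a)

end BottleneckRoutingGame

/-! ## Machine model: a unit-cost random access machine

A program is a while-program over registers and arrays of natural numbers, each program using
finitely many of them. The arithmetic is addition and truncated subtraction; every node of an
expression that is evaluated and every instruction that is executed costs one step. -/

namespace RAM

structure State where
  reg : ℕ → ℕ
  arr : ℕ → ℕ → ℕ

inductive Expr where
  | const (k : ℕ)
  | reg (r : ℕ)
  | read (b : ℕ) (i : Expr)
  | add (e f : Expr)
  | sub (e f : Expr)

/-- The value of an expression; `read b i` is the content of cell `i` of array `b`. -/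
def Expr.eval (σ : State) : Expr → ℕ
  | .const k => k
  | .reg r => σ.reg r
  | .read b i => σ.arr b (i.eval σ)
  | .add e f => e.eval σ + f.eval σ
  | .sub e f => e.eval σ - f.eval σ

/-- The number of nodes of an expression, which is the cost of evaluating it. -/
def Expr.size : Expr → ℕ
  | .const _ => 1
  | .reg _ => 1
  | .read _ i => i.size + 1
  | .add e f => e.size + f.size + 1
  | .sub e f => e.size + f.size + 1

def State.setReg (σ : State) (r v : ℕ) : State :=
  { σ with reg := Function.update σ.reg r v }

def State.setArr (σ : State) (b i v : ℕ) : State :=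
  { σ with arr := Function.update σ.arr b (Function.update (σ.arr b) i v) }

inductive Program where
  | skip
  | assign (r : ℕ) (e : Expr)
  | write (b : ℕ) (i e : Expr)
  | seq (P Q : Program)
  | cond (e : Expr) (P Q : Program)
  | loop (e : Expr) (P : Program)

/-- `Exec P σ k τ`: started in state `σ`, the program `P` halts in state `τ` after exactly `k`
steps. The tests of `cond` and `loop` succeed when the value of the expression is nonzero. -/
inductive Exec : Program → State → ℕ → State → Prop
  | skip (σ : State) : Exec .skip σ 1 σ
  | assign (r : ℕ) (e : Expr) (σ : State) :
      Exec (.assign r e) σ (e.size + 1) (σ.setReg r (e.eval σ))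
  | write (b : ℕ) (i e : Expr) (σ : State) :
      Exec (.write b i e) σ (i.size + e.size + 1) (σ.setArr b (i.eval σ) (e.eval σ))
  | seq {P Q : Program} {σ τ ρ : State} {k l : ℕ} :
      Exec P σ k τ → Exec Q τ l ρ → Exec (.seq P Q) σ (k + l) ρ
  | condTrue {e : Expr} {P Q : Program} {σ τ : State} {k : ℕ} :
      e.eval σ ≠ 0 → Exec P σ k τ → Exec (.cond e P Q) σ (e.size + 1 + k) τ
  | condFalse {e : Expr} {P Q : Program} {σ τ : State} {k : ℕ} :
      e.eval σ = 0 → Exec Q σ k τ → Exec (.cond e P Q) σ (e.size + 1 + k) τ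
  | loopTrue {e : Expr} {P : Program} {σ τ ρ : State} {k l : ℕ} :
      e.eval σ ≠ 0 → Exec P σ k τ → Exec (.loop e P) τ l ρ →
      Exec (.loop e P) σ (e.size + 1 + k + l) ρ
  | loopFalse {e : Expr} {P : Program} {σ : State} :
      e.eval σ = 0 → Exec (.loop e P) σ (e.size + 1) σ

/-- The machine is deterministic. -/
theorem Exec.deterministic {P : Program} {σ τ τ' : State} {k k' : ℕ}
    (h : Exec P σ k τ) (h' : Exec P σ k' τ') : k = k' ∧ τ = τ' := by
  induction h generalizing k' τ' with
  | skip => cases h'; simp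
  | assign => cases h'; simp
  | write => cases h'; simp
  | seq _ _ ih₁ ih₂ =>
    cases h' with
    | seq g₁ g₂ =>
      obtain ⟨rfl, rfl⟩ := ih₁ g₁
      obtain ⟨rfl, rfl⟩ := ih₂ g₂
      simp
  | condTrue hne _ ih =>
    cases h' with
    | condTrue _ g => obtain ⟨rfl, rfl⟩ := ih g; simp
    | condFalse h0 _ => exact absurd h0 hne
  | condFalse h0 _ ih =>
    cases h' with
    | condTrue hne _ => exact absurd h0 hne
    | condFalse _ g => obtain ⟨rfl, rfl⟩ := ih g; simp
  | loopTrue hne _ _ ih₁ ih₂ =>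
    cases h' with
    | loopTrue _ g₁ g₂ =>
      obtain ⟨rfl, rfl⟩ := ih₁ g₁
      obtain ⟨rfl, rfl⟩ := ih₂ g₂
      simp
    | loopFalse h0 => exact absurd h0 hne
  | loopFalse h0 =>
    cases h' with
    | loopTrue hne _ _ => exact absurd h0 hne
    | loopFalse _ => simp

/-- The initial state: the input word is in array `0`, everything else is zero. -/
def initial (w : List ℕ) : State where
  reg := fun _ => 0
  arr := fun b i => if b = 0 then w.getD i 0 else 0

/-- The word `w` is written in array `1`, starting from cell `0`. -/
def State.Outputs (σ : State) (w : List ℕ) : Prop :=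
  ∀ i, ∀ h : i < w.length, σ.arr 1 i = w[i]

/-- The search problem of finding, for an instance `I`, some `y` with `R I y` is solved by an
algorithm whose running time is polynomial in `size I`; `encIn` and `encOut` are the encodings of
instances and of solutions. -/
def SolvableInPolyTime {ι : Type*} {κ : ι → Type*} (encIn : ι → List ℕ) (size : ι → ℕ)
    (encOut : ∀ I, κ I → List ℕ) (R : ∀ I, κ I → Prop) : Prop :=
  ∃ (P : Program) (p : Polynomial ℕ), ∀ I : ι, ∃ (k : ℕ) (τ : State) (y : κ I),
    Exec P (initial (encIn I)) k τ ∧ k ≤ p.eval (size I) ∧ τ.Outputs (encOut I y) ∧ R I y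

end RAM

/-! ## Single-commodity instances with unit demands -/

/-- The combinatorial data of a single-source single-sink game: a finite directed graph, a source,
a sink that is reachable from it, and a positive number of players. -/
structure RoutingInstance where
  numVertices : ℕ
  numArcs : ℕ
  graph : DirGraph (Fin numVertices) (Fin numArcs)
  source : Fin numVertices
  sink : Fin numVertices
  numPlayers : ℕ
  source_ne_sink : source ≠ sink
  exists_path : ∃ p, graph.IsPath source p sink
  numPlayers_pos : 0 < numPlayers

namespace RoutingInstance

variable (I : RoutingInstance)

/-- The bottleneck routing game on `I` in which all players have demand one and all arcs have
the same non-decreasing cost function `c`. -/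
def game (c : ℝ≥0 → ℝ≥0) (hc : Monotone c) :
    BottleneckRoutingGame (Fin I.numPlayers) (Fin I.numVertices) (Fin I.numArcs) where
  graph := I.graph
  src := fun _ => I.source
  snk := fun _ => I.sink
  demand := fun _ => 1
  demand_pos := fun _ => one_pos
  cost := fun _ => c
  cost_mono := fun _ => hc

/-- The strategy profiles: one path from the source to the sink for each player. -/
abbrev Profile := Fin I.numPlayers → I.graph.PathFromTo I.source I.sink

/-- The size of an instance; it bounds every number in the encoding. -/
def size : ℕ := I.numVertices + I.numArcs + I.numPlayers

/-- Input format: the header, followed by the tail and the head of each arc. -/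
def encode : List ℕ :=
  [I.numVertices, I.numArcs, I.source, I.sink, I.numPlayers] ++
    (List.finRange I.numArcs).flatMap fun a => [(I.graph.tail a : ℕ), (I.graph.head a : ℕ)]

/-- Output format: for each player, the length of her path followed by its arcs. -/
def encodeProfile (x : I.Profile) : List ℕ :=
  (List.finRange I.numPlayers).flatMap fun i => (x i).1.length :: (x i).1.map Fin.val

end RoutingInstance

/-! The equilibrium claim is a counting argument on a minimum cut. With `m` arc-disjoint paths and a
minimum cut of `m` arcs, each path crosses the cut in exactly one arc, and every cut arc arises this
way. An even spread puts `r` or `r + 1` players on each path. If all members of a coalition improve,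
the new load of every arc on a member's new path is below the old load of her old path, hence at
most `r`; cut arcs avoided by the coalition can only lose players. So no cut arc gains load, while
every player still crosses the cut: all cut loads are unchanged. A deviating player now crosses an
arc of load `r`, so her old path carried `r + 1`. The cut arc she left still carries `r + 1`, yet a
deviator on it would force load at most `r`, and without deviators it has lost her. This is
`isStrongNash_of_isEvenSpread`; it needs only monotonicity of `c`, so the program never has to know
`c`.

The even spread is computed by augmenting paths. Search from the source in the residual graph and
invert the flow along the tree path to the sink, until the labelled vertices form a tight cut
(`run_maxFlow`). The same search and walk, restricted to flow arcs and run from the sink, then peel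
off the `m` paths one at a time (`run_extractPaths`). Repeating the list of paths cyclically gives
player `i` the path `i % m` (`run_repeatOutput`, `ncard_mod_eq`).

Polynomial time is obtained once and for all: the program uses only loops of `size + 1` rounds, so
its syntax determines a polynomial time bound (`exec_toProgram`), and correctness is proved about
the total function `Code.run`. -/

namespace RAM

/-! ### Bounded-loop programs: semantics, frame rules, running time -/

@[simp] theorem State.setReg_reg (σ : State) (r v q : ℕ) :
    (σ.setReg r v).reg q = if q = r then v else σ.reg q := by
  simp [State.setReg, Function.update_apply]

@[simp] theorem State.setReg_arr (σ : State) (r v : ℕ) : (σ.setReg r v).arr = σ.arr := rfl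

@[simp] theorem State.setArr_reg (σ : State) (b i v : ℕ) : (σ.setArr b i v).reg = σ.reg := rfl

@[simp] theorem State.setArr_arr (σ : State) (b i v c j : ℕ) :
    (σ.setArr b i v).arr c j = if c = b ∧ j = i then v else σ.arr c j := by
  by_cases hc : c = b
  · subst hc
    simp [State.setArr, Function.update_apply]
  · simp [State.setArr, hc]

/-- Programs whose only loops are bounded: `forTo r P` runs `P` with `r = 0, …, N - 1`,
where `N` is the content of register `0`. -/
inductive Code where
  | skip
  | assign (r : ℕ) (e : Expr)
  | write (b : ℕ) (i e : Expr)
  | seq (P Q : Code)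
  | cond (e : Expr) (P Q : Code)
  | forTo (r : ℕ) (P : Code)

namespace Code

-- In `forTo` the counter is set before each round and once more at the end, so that the states at
-- the loop head agree with those of the while-loop in `toProgram`.
@[simp] def run : Code → State → State
  | skip, σ => σ
  | assign r e, σ => σ.setReg r (e.eval σ)
  | write b i e, σ => σ.setArr b (i.eval σ) (e.eval σ)
  | seq P Q, σ => Q.run (P.run σ)
  | cond e P Q, σ => if e.eval σ ≠ 0 then P.run σ else Q.run σ
  | forTo r P, σ =>
    State.setReg (Nat.rec σ (fun i τ => P.run (τ.setReg r i)) (σ.reg 0)) r (σ.reg 0)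

def toProgram : Code → Program
  | skip => .skip
  | assign r e => .assign r e
  | write b i e => .write b i e
  | seq P Q => .seq P.toProgram Q.toProgram
  | cond e P Q => .cond e P.toProgram Q.toProgram
  | forTo r P => .seq (.assign r (.const 0)) (.loop (.sub (.reg 0) (.reg r))
      (.seq P.toProgram (.assign r (.add (.reg r) (.const 1)))))

/-- The registers that a code may change. -/
def regs : Code → List ℕ
  | skip => []
  | assign r _ => [r]
  | write _ _ _ => []
  | seq P Q => P.regs ++ Q.regs
  | cond _ P Q => P.regs ++ Q.regs
  | forTo r P => r :: P.regs

/-- The arrays that a code may change. -/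
def arrs : Code → List ℕ
  | skip => []
  | assign _ _ => []
  | write b _ _ => [b]
  | seq P Q => P.arrs ++ Q.arrs
  | cond _ P Q => P.arrs ++ Q.arrs
  | forTo _ P => P.arrs

/-- Loop counters and the loop bound are not changed by loop bodies. -/
def WellFormed : Code → Prop
  | skip => True
  | assign r _ => r ≠ 0
  | write _ _ _ => True
  | seq P Q => P.WellFormed ∧ Q.WellFormed
  | cond _ P Q => P.WellFormed ∧ Q.WellFormed
  | forTo r P => r ≠ 0 ∧ r ∉ P.regs ∧ P.WellFormed

/-- Running time as a polynomial in the loop bound. -/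
noncomputable def time : Code → Polynomial ℕ
  | skip => 1
  | assign _ e => Polynomial.C (e.size + 1)
  | write _ i e => Polynomial.C (i.size + e.size + 1)
  | seq P Q => P.time + Q.time
  | cond e P Q => Polynomial.C (e.size + 1) + P.time + Q.time
  | forTo _ P => 2 + (Polynomial.X * (P.time + 8) + 4)

theorem run_reg (P : Code) (σ : State) (r : ℕ) (h : r ∉ P.regs) :
    (P.run σ).reg r = σ.reg r := by
  induction P generalizing σ with
  | skip => rfl
  | assign q e =>
    have : r ≠ q := by simpa [regs] using h
    simp [this]
  | write => rfl
  | seq P Q ihP ihQ =>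
    simp only [regs, List.mem_append, not_or] at h
    simp [ihP _ h.1, ihQ _ h.2]
  | cond e P Q ihP ihQ =>
    simp only [regs, List.mem_append, not_or] at h
    simp only [run]
    split
    · exact ihP _ h.1
    · exact ihQ _ h.2
  | forTo q P ih =>
    simp only [regs, List.mem_cons, not_or] at h
    simp only [run, State.setReg_reg, if_neg h.1]
    induction σ.reg 0 with
    | zero => rfl
    | succ k ihk => simp [ih _ h.2, h.1, ihk]

theorem run_arr (P : Code) (σ : State) (b : ℕ) (h : b ∉ P.arrs) :
    (P.run σ).arr b = σ.arr b := by
  induction P generalizing σ with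
  | skip => rfl
  | assign q e => rfl
  | write c i e =>
    have : b ≠ c := by simpa [arrs] using h
    funext j
    simp [this]
  | seq P Q ihP ihQ =>
    simp only [arrs, List.mem_append, not_or] at h
    simp [ihP _ h.1, ihQ _ h.2]
  | cond e P Q ihP ihQ =>
    simp only [arrs, List.mem_append, not_or] at h
    simp only [run]
    split
    · exact ihP _ h.1
    · exact ihQ _ h.2
  | forTo q P ih =>
    simp only [run, State.setReg_arr]
    induction σ.reg 0 with
    | zero => rfl
    | succ k ihk => simp [ih _ h, ihk]

theorem WellFormed.zero_notMem_regs {P : Code} (h : P.WellFormed) : 0 ∉ P.regs := by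
  induction P with
  | skip => simp [regs]
  | assign r e => simpa [regs] using Ne.symm h
  | write => simp [regs]
  | seq P Q ihP ihQ => simp [regs, ihP h.1, ihQ h.2]
  | cond e P Q ihP ihQ => simp [regs, ihP h.1, ihQ h.2]
  | forTo r P ih => simp [regs, ih h.2.2, Ne.symm h.1]

/-- Invariant rule for bounded loops. -/
theorem run_forTo_induction {r : ℕ} {P : Code} {σ : State}
    (Inv : ℕ → State → Prop) (hreg : ∀ i τ v, Inv i τ → Inv i (τ.setReg r v)) (init : Inv 0 σ)
    (step : ∀ i τ, i < σ.reg 0 → (∀ q, q ∉ (forTo r P).regs → τ.reg q = σ.reg q) →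
      (∀ b, b ∉ P.arrs → τ.arr b = σ.arr b) → τ.reg r = i → Inv i τ → Inv (i + 1) (P.run τ)) :
    Inv (σ.reg 0) ((forTo r P).run σ) := by
  simp only [regs, List.mem_cons, not_or] at step
  -- The frame conditions are carried along with `Inv`, so that `step` may use them.
  have key : ∀ k, k ≤ σ.reg 0 → ∀ τ : State,
      τ = Nat.rec σ (fun i τ => P.run (τ.setReg r i)) k →
        (∀ q, ¬q = r ∧ q ∉ P.regs → τ.reg q = σ.reg q) ∧ (∀ b, b ∉ P.arrs → τ.arr b = σ.arr b) ∧
          Inv k τ := by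
    intro k
    induction k with
    | zero => rintro _ _ rfl; exact ⟨fun _ _ => rfl, fun _ _ => rfl, init⟩
    | succ k ih =>
      rintro hk _ rfl
      obtain ⟨h1, h2, h3⟩ := ih (by omega) _ rfl
      refine ⟨fun q hq => ?_, fun b hb => ?_, ?_⟩
      · simp only []
        rw [run_reg _ _ _ hq.2]
        simpa [hq.1] using h1 q hq
      · simp only []
        rw [run_arr _ _ _ hb]
        exact h2 b hb
      · exact step k _ (by omega) (fun q hq => by simpa [hq.1] using h1 q hq) h2 (by simp)
          (hreg _ _ _ h3)
  exact hreg _ _ _ (key _ le_rfl _ rfl).2.2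

/-- Well-formedness keeps register `0` and the counter out of reach of the body, so the while-loop
makes exactly the prescribed rounds. Each round costs 4 for the test and 4 for the increment besides
the body; the last test costs 4 and the initialisation 2. -/
theorem exec_toProgram {P : Code} (h : P.WellFormed) (σ : State) :
    ∃ k, Exec P.toProgram σ k (P.run σ) ∧ k ≤ P.time.eval (σ.reg 0) := by
  induction P generalizing σ with
  | skip => exact ⟨_, .skip σ, by simp [time]⟩
  | assign r e => exact ⟨_, .assign r e σ, by simp [time]⟩
  | write b i e => exact ⟨_, .write b i e σ, by simp [time]⟩
  | seq P Q ihP ihQ =>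
    obtain ⟨k, hk, hkt⟩ := ihP h.1 σ
    obtain ⟨l, hl, hlt⟩ := ihQ h.2 (P.run σ)
    rw [run_reg _ _ _ h.1.zero_notMem_regs] at hlt
    refine ⟨_, .seq hk hl, ?_⟩
    simp only [time, Polynomial.eval_add]
    omega
  | cond e P Q ihP ihQ =>
    by_cases he : e.eval σ = 0
    · obtain ⟨k, hk, hkt⟩ := ihQ h.2 σ
      refine ⟨_, by simpa [he, toProgram] using Exec.condFalse he hk, ?_⟩
      simp only [time, Polynomial.eval_add, Polynomial.eval_C]
      omega
    · obtain ⟨k, hk, hkt⟩ := ihP h.1 σ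
      refine ⟨_, by simpa [he, toProgram] using Exec.condTrue he hk, ?_⟩
      simp only [time, Polynomial.eval_add, Polynomial.eval_C]
      omega
  | forTo r P ih =>
    obtain ⟨hr0, hrP, hP⟩ := h
    set N := σ.reg 0 with hN
    set it : ℕ → State := fun k => Nat.rec σ (fun i τ => P.run (τ.setReg r i)) k with hit
    have hit0 : ∀ k, (it k).reg 0 = N := by
      intro k
      induction k with
      | zero => rfl
      | succ k ihk =>
        change (P.run ((it k).setReg r k)).reg 0 = N
        rw [run_reg _ _ _ hP.zero_notMem_regs]
        simpa [Ne.symm hr0] using ihk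
    -- Induction on the number `d` of rounds left; at the loop head the state is `(it k).setReg r
    -- k`.
    have key : ∀ d k, k + d = N → ∃ l, Exec (.loop (.sub (.reg 0) (.reg r))
        (.seq P.toProgram (.assign r (.add (.reg r) (.const 1))))) ((it k).setReg r k) l
          ((it N).setReg r N) ∧ l ≤ d * (P.time.eval N + 8) + 4 := by
      intro d
      induction d with
      | zero =>
        rintro k hk
        obtain rfl : k = N := by omega
        refine ⟨_, .loopFalse ?_, ?_⟩
        · simp [Expr.eval, Ne.symm hr0, hit0]
        · simp [Expr.size]
      | succ d ihd =>
        rintro k hk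
        obtain ⟨l, hl, hlt⟩ := ihd (k + 1) (by omega)
        obtain ⟨j, hj, hjt⟩ := ih hP ((it k).setReg r k)
        have hj0 : ((it k).setReg r k).reg 0 = N := by simp [Ne.symm hr0, hit0]
        rw [hj0] at hjt
        have hstep : Exec (.assign r (.add (.reg r) (.const 1))) (it (k + 1)) 4
            ((it (k + 1)).setReg r (k + 1)) := by
          have hrk : (it (k + 1)).reg r = k := by
            change (P.run ((it k).setReg r k)).reg r = k
            rw [run_reg _ _ _ hrP]
            simp
          simpa [Expr.size, Expr.eval, hrk] using
            Exec.assign r (.add (.reg r) (.const 1)) (it (k + 1))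
        refine ⟨_, .loopTrue ?_ (.seq hj hstep) hl, ?_⟩
        · simp only [Expr.eval, State.setReg_reg, if_neg (Ne.symm hr0), hit0, if_true]
          omega
        · simp only [Expr.size]
          rw [Nat.succ_mul]
          omega
    obtain ⟨l, hl, hlt⟩ := key N 0 (by omega)
    refine ⟨_, .seq (.assign r (.const 0) σ) hl, ?_⟩
    simp only [time, Expr.size, Polynomial.eval_add, Polynomial.eval_mul, Polynomial.eval_X,
      Polynomial.eval_ofNat]
    omega

end Code

end RAM

/-! ### Unit-capacity flows and cuts -/

namespace DirGraph

variable {V A : Type*} (D : DirGraph V A)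

theorem IsWalk.exists_mem_outArcs {D : DirGraph V A} {U : Set V} {p : List A} {u v : V}
    (h : D.IsWalk u p v) (hu : u ∈ U) (hv : v ∉ U) : ∃ a ∈ p, a ∈ D.outArcs U := by
  induction p generalizing u with
  | nil => exact absurd ((show u = v from h) ▸ hu) hv
  | cons a q ih =>
    obtain ⟨rfl, hq⟩ := h
    by_cases ha : D.head a ∈ U
    · obtain ⟨b, hb, hbU⟩ := ih hq ha
      exact ⟨b, List.mem_cons_of_mem _ hb, hbU⟩
    · exact ⟨a, List.mem_cons_self, hu, ha⟩

theorem IsWalk.concat {D : DirGraph V A} {p : List A} {u : V} {a : A}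
    (h : D.IsWalk u p (D.tail a)) : D.IsWalk u (p ++ [a]) (D.head a) := by
  induction p generalizing u with
  | nil => exact ⟨Eq.symm h, rfl⟩
  | cons b q ih => exact ⟨h.1, ih h.2⟩

/-- The net outflow of the arc set `F` at the vertex `v`. -/
def netOut [DecidableEq V] (F : Finset A) (v : V) : ℤ :=
  ∑ a ∈ F, ((if D.tail a = v then 1 else 0) - (if D.head a = v then 1 else 0))

/-- The arc set `F` is an integral `(s,t)`-flow of value `k` for unit capacities. -/
def IsUnitFlow [DecidableEq V] (s t : V) (F : Finset A) (k : ℤ) : Prop :=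
  ∀ v, D.netOut F v = k * ((if s = v then 1 else 0) - (if t = v then 1 else 0))

theorem netOut_insert [DecidableEq V] [DecidableEq A] {F : Finset A} {a : A} (ha : a ∉ F) (v : V) :
    D.netOut (insert a F) v = D.netOut F v +
      ((if D.tail a = v then 1 else 0) - (if D.head a = v then 1 else 0)) := by
  simp only [netOut]
  rw [Finset.sum_insert ha, add_comm]

theorem netOut_erase [DecidableEq V] [DecidableEq A] {F : Finset A} {a : A} (ha : a ∈ F) (v : V) :
    D.netOut (F.erase a) v = D.netOut F v -
      ((if D.tail a = v then 1 else 0) - (if D.head a = v then 1 else 0)) := by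
  simp only [netOut]
  rw [Finset.sum_erase_eq_sub ha]

variable {D} {s t : V} {F : Finset A} {k : ℤ}

-- Sum the net outflow over `U`: conservation leaves only the source, and arcs with both ends in `U`
-- cancel.
open Classical in
theorem IsUnitFlow.value_eq [DecidableEq V] [Fintype V] (h : D.IsUnitFlow s t F k) {U : Set V} (hs : s ∈ U)
    (ht : t ∉ U) :
    k = ∑ a ∈ F, ((if D.tail a ∈ U then 1 else 0) - (if D.head a ∈ U then 1 else 0)) := by
  have h1 : ∑ v ∈ U.toFinset, D.netOut F v = k := by
    simp only [h _, ← Finset.mul_sum, Finset.sum_sub_distrib, Finset.sum_ite_eq]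
    simp [hs, ht]
  rw [← h1]
  simp only [netOut]
  rw [Finset.sum_comm]
  refine Finset.sum_congr rfl fun a _ => ?_
  simp only [Finset.sum_sub_distrib, Finset.sum_ite_eq, Set.mem_toFinset]

-- Weak duality: in the sum over arcs only those leaving `U` contribute positively, each at most
-- once.
open Classical in
theorem IsUnitFlow.value_le [DecidableEq V] [Fintype V] [Fintype A] (h : D.IsUnitFlow s t F k) {U : Set V}
    (hs : s ∈ U) (ht : t ∉ U) : k ≤ (D.outArcs U).ncard := by
  rw [h.value_eq hs ht, Set.ncard_eq_toFinset_card']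
  calc _ ≤ ∑ a ∈ F, (if a ∈ D.outArcs U then (1 : ℤ) else 0) := by
        refine Finset.sum_le_sum fun a _ => ?_
        by_cases h1 : D.tail a ∈ U <;> by_cases h2 : D.head a ∈ U <;> simp [outArcs, h1, h2]
    _ ≤ ∑ a, (if a ∈ D.outArcs U then (1 : ℤ) else 0) :=
        Finset.sum_le_sum_of_subset_of_nonneg (Finset.subset_univ _) fun a _ _ => by
          split <;> simp
    _ = _ := by simp [Set.toFinset_card, Fintype.card_subtype]

open Classical in
/-- A flow that saturates the cut of `U`, with no arc of the flow entering `U`, has the capacity of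
the cut as its value. -/
theorem IsUnitFlow.value_eq_ncard [DecidableEq V] [Fintype V] [Fintype A] (h : D.IsUnitFlow s t F k) {U : Set V}
    (hs : s ∈ U) (ht : t ∉ U) (hout : ∀ a, D.tail a ∈ U → a ∉ F → D.head a ∈ U)
    (hin : ∀ a ∈ F, D.head a ∈ U → D.tail a ∈ U) : k = (D.outArcs U).ncard := by
  rw [h.value_eq hs ht, Set.ncard_eq_toFinset_card']
  have h1 : (D.outArcs U).toFinset ⊆ F := by
    intro a ha
    rw [Set.mem_toFinset] at ha
    by_contra haF
    exact ha.2 (hout a ha.1 haF)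
  calc _ = ∑ a ∈ F, (if a ∈ (D.outArcs U).toFinset then (1 : ℤ) else 0) := by
        refine Finset.sum_congr rfl fun a haF => ?_
        have := hin a haF
        simp only [Set.mem_toFinset]
        by_cases h1 : D.tail a ∈ U <;> by_cases h2 : D.head a ∈ U <;> simp_all [outArcs]
    _ = _ := by
      rw [← Finset.sum_filter, Finset.filter_mem_eq_inter, Finset.inter_eq_right.2 h1]
      simp

theorem IsUnitFlow.isMinCut [DecidableEq V] [Fintype V] [Fintype A] (h : D.IsUnitFlow s t F k) {U : Set V}
    (hs : s ∈ U) (ht : t ∉ U) (hk : k = (D.outArcs U).ncard) : D.IsMinCut s t U := by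
  refine ⟨hs, ht, fun W hsW htW => ?_⟩
  have := h.value_le hsW htW
  omega

end DirGraph

/-! ### Even spreads are strong equilibria -/

namespace RoutingInstance

variable {I : RoutingInstance}

theorem load_game (c : ℝ≥0 → ℝ≥0) (hc : Monotone c) (y : I.Profile) (a : Fin I.numArcs) :
    (I.game c hc).load y a = (Finset.univ.filter fun i => a ∈ (y i).1).card := by
  simp [BottleneckRoutingGame.load, game]

/-- Spreading the players evenly over the paths of a maximum flow is a strong equilibrium. -/
theorem isStrongNash_of_isEvenSpread {x : I.Profile}
    (h : I.graph.IsEvenSpread I.source I.sink x) (c : ℝ≥0 → ℝ≥0) (hc : Monotone c) :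
    IsStrongNash (I.game c hc).privateCost x := by
  classical
  obtain ⟨m, P, ⟨U, hU, hm⟩, hdisj, φ, hx, hcard⟩ := h
  rintro ⟨S, ⟨i₀, hi₀⟩, y, hyS, hlt⟩
  set cnt : Fin m → ℕ := fun j => (Finset.univ.filter fun i => φ i = j).card with hcnt
  set ld : Fin I.numArcs → ℕ := fun a => (Finset.univ.filter fun i => a ∈ (y i).1).card with hld
  have hm0 : 0 < m := (φ i₀).pos
  obtain ⟨r, hr⟩ : ∃ r, ∀ j, r ≤ cnt j ∧ cnt j ≤ r + 1 := by
    refine ⟨I.numPlayers / m, fun j => ?_⟩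
    have h1 : I.numPlayers / m ≤ I.numPlayers ⌈/⌉ m := by
      rw [Nat.ceilDiv_eq_add_pred_div]
      exact Nat.div_le_div_right (by omega)
    have h2 : I.numPlayers ⌈/⌉ m ≤ I.numPlayers / m + 1 := by
      rw [Nat.ceilDiv_eq_add_pred_div, ← Nat.add_div_right _ hm0]
      exact Nat.div_le_div_right (by omega)
    have h3 := hcard j
    rw [Set.ncard_eq_toFinset_card', Set.toFinset_ofPred] at h3
    simp only [hcnt]
    omega
  -- `c (ld a) ≤ π y i < π x i ≤ c (cnt (φ i))`, and a monotone `c` reflects strict inequality. The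
  -- last bound uses disjointness: an arc of `P j` is used in `x` only by the `cnt j` players on `P
  -- j`.
  have hcost : ∀ i ∈ S, ∀ a ∈ (y i).1, ld a < cnt (φ i) := by
    intro i hi a ha
    have h1 : c (ld a) ≤ (I.game c hc).privateCost y i := by
      have := Finset.le_sup (f := fun a => (I.game c hc).cost a ((I.game c hc).load y a))
        (List.mem_toFinset.2 ha)
      rw [load_game c hc y a] at this
      exact this
    have h2 : (I.game c hc).privateCost x i ≤ c (cnt (φ i)) := by
      refine Finset.sup_le fun b hb => ?_
      rw [load_game c hc x b]
      refine hc ?_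
      have hb' : b ∈ (P (φ i)).1 := by
        rw [← hx i]
        exact List.mem_toFinset.1 hb
      refine Nat.cast_le.2 (Finset.card_le_card fun i' hi' => ?_)
      simp only [Finset.mem_filter, Finset.mem_univ, true_and] at hi' ⊢
      rw [hx i'] at hi'
      by_contra hne
      exact hdisj _ _ hne hi' hb'
    exact Nat.cast_lt.1 (hc.reflect_lt (h1.trans_lt ((hlt i hi).trans_le h2)))
  have hcross : ∀ p : I.graph.PathFromTo I.source I.sink, ∃ a ∈ p.1, a ∈ I.graph.outArcs U :=
    fun p => p.2.1.exists_mem_outArcs hU.1 hU.2.1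
  choose g hgP hgU using fun j => hcross (P j)
  have hginj : Function.Injective g := by
    intro j l hjl
    by_contra hne
    exact hdisj j l hne (hgP j) (hjl ▸ hgP l)
  -- `g` is injective into a cut of exactly `m` arcs.
  have hgsurj : ∀ a ∈ I.graph.outArcs U, ∃ j, g j = a := by
    have : Finset.univ.image g = (I.graph.outArcs U).toFinset := by
      refine Finset.eq_of_subset_of_card_le ?_ ?_
      · intro a ha
        obtain ⟨j, -, rfl⟩ := Finset.mem_image.1 ha
        exact Set.mem_toFinset.2 (hgU j)
      · rw [Finset.card_image_of_injective _ hginj, ← Set.ncard_eq_toFinset_card']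
        simp [hm]
    intro a ha
    rw [← Set.mem_toFinset, ← this] at ha
    simpa using ha
  -- If a deviator `i` uses `g j`, its load is below `cnt (φ i) ≤ r + 1`, hence at most `r ≤ cnt j`.
  -- Otherwise only players who stay on `P j` use it, and the loss is strict if a member of `S` came
  -- from `P j`.
  have hle : ∀ j, ld (g j) ≤ cnt j ∧
      ((∀ i ∈ S, g j ∉ (y i).1) → ∀ i ∈ S, φ i = j → ld (g j) < cnt j) := by
    intro j
    by_cases hS : ∃ i ∈ S, g j ∈ (y i).1
    · obtain ⟨i, hi, hgi⟩ := hS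
      have := hcost i hi _ hgi
      exact ⟨by have := hr j; have := hr (φ i); omega, fun h => absurd hgi (h i hi)⟩
    · push Not at hS
      have hsub : (Finset.univ.filter fun i => g j ∈ (y i).1) ⊆
          Finset.univ.filter fun i => φ i = j := by
        intro i hi
        simp only [Finset.mem_filter, Finset.mem_univ, true_and] at hi ⊢
        have hiS : i ∉ S := fun hiS => hS i hiS hi
        rw [hyS i hiS, hx i] at hi
        by_contra hne
        exact hdisj _ _ hne hi (hgP j)
      refine ⟨Finset.card_le_card hsub, fun _ i hi hij => Finset.card_lt_card ?_⟩
      refine (Finset.ssubset_iff_of_subset hsub).2 ⟨i, by simpa using hij, ?_⟩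
      simpa using hS i hi
  -- The new path of each of the `n` players still crosses the cut, so the cut loads sum to at least
  -- `n`.
  have hsum : ∑ j, ld (g j) = ∑ j, cnt j := by
    refine le_antisymm (Finset.sum_le_sum fun j _ => (hle j).1) ?_
    have h1 : ∑ j, cnt j = ∑ i : Fin I.numPlayers, 1 := by
      simp only [hcnt, Finset.card_filter]
      rw [Finset.sum_comm]
      simp
    rw [h1]
    simp only [hld, Finset.card_filter]
    rw [Finset.sum_comm]
    refine Finset.sum_le_sum fun i _ => ?_
    obtain ⟨a, ha, haU⟩ := hcross (y i)
    obtain ⟨j, rfl⟩ := hgsurj a haU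
    calc 1 = (if g j ∈ (y i).1 then 1 else 0) := by rw [if_pos ha]
      _ ≤ _ := Finset.single_le_sum (f := fun j => if g j ∈ (y i).1 then 1 else 0)
        (fun _ _ => Nat.zero_le _) (Finset.mem_univ j)
  have heq : ∀ j, ld (g j) = cnt j := fun j =>
    (Finset.sum_eq_sum_iff_of_le fun j _ => (hle j).1).1 hsum j (Finset.mem_univ j)
  obtain ⟨a, ha, haU⟩ := hcross (y i₀)
  obtain ⟨j, rfl⟩ := hgsurj a haU
  have h1 := hcost i₀ hi₀ _ ha
  rw [heq j] at h1
  -- By now `cnt j = r` and `cnt (φ i₀) = r + 1`; a deviator on `g (φ i₀)` would need a path with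
  -- more than `r + 1` players.
  by_cases hS : ∃ i ∈ S, g (φ i₀) ∈ (y i).1
  · obtain ⟨i, hi, hgi⟩ := hS
    have h2 := hcost i hi _ hgi
    rw [heq] at h2
    have := hr j
    have := hr (φ i)
    omega
  · push Not at hS
    exact absurd (heq _) ((hle _).2 hS i₀ hi₀ rfl).ne

end RoutingInstance

namespace RoutingInstance

open RAM

/-! ### The program -/

/-- Arrays: `0` input, `1` output, `2` flow indicator, `3` labels, `4` parent arcs. Registers: `0`
loop bound, `1`–`4` counters, `5` current vertex, `6` output position, `7` cell for the path length,
`8` flow value, `9` current arc, `10` length of the period. The header takes five cells, and each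
arc takes two. -/
def tailExpr (a : Expr) : Expr := .read 0 (.add (.const 5) (.add a a))

def headExpr (a : Expr) : Expr := .read 0 (.add (.const 6) (.add a a))

def sourceExpr : Expr := .read 0 (.const 2)

def sinkExpr : Expr := .read 0 (.const 3)

/-- Label `v` if `u` got its label in an earlier round. -/
def tryLabel (u v : Expr) : Code :=
  .cond (.read 3 u) (.cond (.sub (.const 1) (.read 3 v))
    (.cond (.sub (.add (.reg 2) (.const 2)) (.read 3 u))
      (.seq (.write 3 v (.add (.reg 2) (.const 2))) (.write 4 v (.reg 1))) .skip) .skip) .skip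

/-- The common loop bound exceeds the number of arcs, hence the first test. A flow arc is searched
from head to tail, an unused one from tail to head. -/
def relax (cap : Bool) : Code :=
  .cond (.sub (.read 0 (.const 1)) (.reg 1))
    (.cond (.read 2 (.reg 1)) (tryLabel (headExpr (.reg 1)) (tailExpr (.reg 1)))
      (if cap then tryLabel (tailExpr (.reg 1)) (headExpr (.reg 1)) else .skip)) .skip

/-- Breadth-first search in the residual graph; unused arcs may be traversed if `cap` holds. -/
def search (x : Expr) (cap : Bool) : Code :=
  .seq (.forTo 1 (.write 3 (.reg 1) (.const 0)))
    (.seq (.write 3 x (.const 1)) (.forTo 2 (.forTo 1 (relax cap))))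

/-- Only the root has label 1, so the rounds left after reaching it do nothing. -/
def walkStep : Code :=
  .cond (.sub (.read 3 (.reg 5)) (.const 1))
    (.seq (.assign 9 (.read 4 (.reg 5)))
      (.seq (.write 1 (.reg 6) (.reg 9))
        (.seq (.assign 6 (.add (.reg 6) (.const 1)))
          (.cond (.read 2 (.reg 9))
            (.seq (.write 2 (.reg 9) (.const 0)) (.assign 5 (headExpr (.reg 9))))
            (.seq (.write 2 (.reg 9) (.const 1)) (.assign 5 (tailExpr (.reg 9)))))))) .skip

/-- Follow the search tree from `y` to the root, invert the flow on the arcs of the tree path, and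
append the tree path to the output. -/
def walk (y : Expr) : Code :=
  .seq (.assign 5 y) (.seq (.assign 7 (.reg 6)) (.seq (.assign 6 (.add (.reg 6) (.const 1)))
    (.seq (.forTo 2 walkStep)
      (.write 1 (.reg 7) (.sub (.sub (.reg 6) (.reg 7)) (.const 1))))))

/-- The walks also write to the output array; `extractPaths` resets the position and overwrites from
cell `0`. -/
def maxFlow : Code :=
  .forTo 3 (.seq (search sourceExpr true)
    (.cond (.read 3 sinkExpr) (.seq (walk sinkExpr) (.assign 8 (.add (.reg 8) (.const 1)))) .skip))

def extractPaths : Code :=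
  .seq (.assign 6 (.const 0)) (.forTo 3 (.cond (.sub (.reg 8) (.reg 3))
    (.seq (search sinkExpr false) (walk sourceExpr)) .skip))

def repeatOutput : Code :=
  .seq (.assign 10 (.reg 6)) (.forTo 3 (.forTo 4
    (.seq (.write 1 (.reg 6) (.read 1 (.sub (.reg 6) (.reg 10))))
      (.assign 6 (.add (.reg 6) (.const 1))))))

def mainCode : Code := .seq maxFlow (.seq extractPaths repeatOutput)

def boundExpr : Expr :=
  .add (.add (.read 0 (.const 0)) (.read 0 (.const 1))) (.add (.read 0 (.const 4)) (.const 1))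

def mainProgram : Program := .seq (.assign 0 boundExpr) mainCode.toProgram

theorem mainCode_wellFormed : mainCode.WellFormed := by
  simp [mainCode, maxFlow, extractPaths, repeatOutput, search, walk, walkStep, relax, tryLabel,
    Code.WellFormed, Code.regs]

/-! ### States that hold the input -/

variable (I : RoutingInstance)

structure Ready (σ : State) : Prop where
  reg_zero : σ.reg 0 = I.size + 1
  arr_zero : σ.arr 0 = fun i => I.encode.getD i 0

theorem getElem?_flatMap_pair {α β : Type*} (f g : α → β) (l : List α) (i : ℕ) :
    (l.flatMap fun a => [f a, g a])[i + i]? = l[i]?.map f ∧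
      (l.flatMap fun a => [f a, g a])[i + i + 1]? = l[i]?.map g := by
  induction l generalizing i with
  | nil => simp
  | cons b l ih =>
    cases i with
    | zero => simp
    | succ i =>
      have h : i + 1 + (i + 1) = i + i + 1 + 1 := by omega
      simpa [h] using ih i

variable {I} {σ : State}

theorem Ready.eval_tail (h : I.Ready σ) {e : Expr} {a : Fin I.numArcs} (he : e.eval σ = a) :
    (tailExpr e).eval σ = I.graph.tail a := by
  have h1 := (getElem?_flatMap_pair (fun a => (I.graph.tail a : ℕ)) (fun a => (I.graph.head a : ℕ))
    (List.finRange I.numArcs) a).1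
  simp only [tailExpr, Expr.eval, h.arr_zero, he, encode, List.getD_eq_getElem?_getD]
  rw [List.getElem?_append_right (by simp)]
  simp [h1]

theorem Ready.eval_head (h : I.Ready σ) {e : Expr} {a : Fin I.numArcs} (he : e.eval σ = a) :
    (headExpr e).eval σ = I.graph.head a := by
  have h1 := (getElem?_flatMap_pair (fun a => (I.graph.tail a : ℕ)) (fun a => (I.graph.head a : ℕ))
    (List.finRange I.numArcs) a).2
  simp only [headExpr, Expr.eval, h.arr_zero, he, encode, List.getD_eq_getElem?_getD]
  rw [List.getElem?_append_right (by simp; omega)]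
  have h2 : 6 + ((a : ℕ) + a) - [I.numVertices, I.numArcs, (I.source : ℕ), (I.sink : ℕ),
      I.numPlayers].length = a + a + 1 := by
    simp only [List.length_cons, List.length_nil]
    omega
  rw [h2, h1]
  simp

theorem Ready.eval_source (h : I.Ready σ) : sourceExpr.eval σ = I.source := by
  simp [sourceExpr, Expr.eval, h.arr_zero, encode]

theorem Ready.eval_sink (h : I.Ready σ) : sinkExpr.eval σ = I.sink := by
  simp [sinkExpr, Expr.eval, h.arr_zero, encode]

theorem Ready.eval_numArcs (h : I.Ready σ) : σ.arr 0 1 = I.numArcs := by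
  simp [h.arr_zero, encode]

theorem Ready.run (h : I.Ready σ) {P : Code} (hr : 0 ∉ P.regs) (ha : 0 ∉ P.arrs) :
    I.Ready (P.run σ) :=
  ⟨by rw [Code.run_reg _ _ _ hr, h.reg_zero], by rw [Code.run_arr _ _ _ ha, h.arr_zero]⟩

theorem Ready.congr {τ : State} (h : I.Ready σ) (hr : τ.reg 0 = σ.reg 0) (ha : τ.arr 0 = σ.arr 0) :
    I.Ready τ :=
  ⟨by rw [hr, h.reg_zero], by rw [ha, h.arr_zero]⟩

/-! ### Residual arcs and labels -/

variable (I)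

/-- The set of arcs that is stored in array `2`. -/
def flowSet (σ : State) : Finset (Fin I.numArcs) := Finset.univ.filter fun a => σ.arr 2 a ≠ 0

variable {I}

@[simp] theorem mem_flowSet {a : Fin I.numArcs} : a ∈ I.flowSet σ ↔ σ.arr 2 a ≠ 0 := by
  simp [flowSet]

theorem flowSet_congr {τ : State} (h : τ.arr 2 = σ.arr 2) : I.flowSet τ = I.flowSet σ := by
  simp [flowSet, h]

variable (I)

/-- The arc `a` can be traversed from `u` to `v` in the residual graph of `F`. -/
def Residual (cap : Bool) (F : Finset (Fin I.numArcs)) (u : Fin I.numVertices)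
    (a : Fin I.numArcs) (v : Fin I.numVertices) : Prop :=
  (a ∈ F ∧ I.graph.head a = u ∧ I.graph.tail a = v) ∨
    (cap = true ∧ a ∉ F ∧ I.graph.tail a = u ∧ I.graph.head a = v)

/-- `lab` and `par` describe a search tree with root `x` and labels at most `R`. -/
structure Labels (cap : Bool) (F : Finset (Fin I.numArcs)) (x : Fin I.numVertices) (R : ℕ)
    (lab par : ℕ → ℕ) : Prop where
  root : lab x = 1
  le : ∀ v : Fin I.numVertices, lab v ≤ R
  pred : ∀ v : Fin I.numVertices, v ≠ x → lab v ≠ 0 → ∃ (u : Fin I.numVertices) (a : Fin I.numArcs),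
    par v = a ∧
    I.Residual cap F u a v ∧ lab u ≠ 0 ∧ lab u < lab v

/-- The labelled vertices are closed under residual arcs. -/
def ClosedLabels (cap : Bool) (F : Finset (Fin I.numArcs)) (lab : ℕ → ℕ) : Prop :=
  ∀ u a v, I.Residual cap F u a v → lab u ≠ 0 → lab v ≠ 0

variable {I} {cap : Bool} {F : Finset (Fin I.numArcs)} {x : Fin I.numVertices} {R : ℕ}
  {lab par : ℕ → ℕ}

/-- For a fixed flow an arc is residual in one direction only. Hence the walk never meets an arc
that it has already inverted. -/
theorem Residual.target_unique {u u' v v' : Fin I.numVertices} {a : Fin I.numArcs}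
    (h : I.Residual cap F u a v) (h' : I.Residual cap F u' a v') : v = v' := by
  rcases h with ⟨h1, -, rfl⟩ | ⟨-, h1, -, rfl⟩ <;> rcases h' with ⟨h2, -, rfl⟩ | ⟨-, h2, -, rfl⟩ <;>
    first | rfl | contradiction

theorem Labels.mono (h : I.Labels cap F x R lab par) {R' : ℕ} (hR : R ≤ R') :
    I.Labels cap F x R' lab par :=
  ⟨h.root, fun v => (h.le v).trans hR, h.pred⟩

theorem Labels.extend (h : I.Labels cap F x R lab par) {u v : Fin I.numVertices}
    {a : Fin I.numArcs} (hres : I.Residual cap F u a v) (hu : lab u ≠ 0) (huR : lab u < R)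
    (hv : lab v = 0) {lab' par' : ℕ → ℕ} (hlab : ∀ w, lab' w = if w = v then R else lab w)
    (hpar : ∀ w, par' w = if w = v then (a : ℕ) else par w) : I.Labels cap F x R lab' par' := by
  have hne : ∀ w : Fin I.numVertices, lab w ≠ 0 → lab' w = lab w := by
    intro w hw
    rw [hlab, if_neg]
    intro hwv
    rw [hwv] at hw
    exact hw hv
  refine ⟨?_, fun w => ?_, fun w hwx hw => ?_⟩
  · rw [hne x (by rw [h.root]; simp), h.root]
  · rw [hlab]
    split
    · exact le_rfl
    · exact h.le w
  · by_cases hwv : w = v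
    · subst hwv
      refine ⟨u, a, by simp [hpar], hres, ?_, ?_⟩
      · rwa [hne u hu]
      · rw [hne u hu, hlab, if_pos rfl]
        exact huR
    · have hwv' : (w : ℕ) ≠ v := fun h => hwv (Fin.ext h)
      rw [hlab, if_neg hwv'] at hw ⊢
      obtain ⟨u', a', h1, h2, h3, h4⟩ := h.pred w hwx hw
      exact ⟨u', a', by rw [hpar, if_neg hwv', h1], h2, by rwa [hne u' h3], by rwa [hne u' h3]⟩

/-- All labelled vertices lie in every set that contains the root and is closed under residual
arcs. -/
theorem Labels.subset_of_closed (h : I.Labels cap F x R lab par) {lab₀ : ℕ → ℕ}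
    (hx : lab₀ x ≠ 0) (hc : I.ClosedLabels cap F lab₀) (v : Fin I.numVertices) (hv : lab v ≠ 0) :
    lab₀ v ≠ 0 := by
  induction hn : lab v using Nat.strong_induction_on generalizing v with
  | _ n ih =>
    subst hn
    by_cases hvx : v = x
    · rwa [hvx]
    · obtain ⟨u, a, -, hres, hu, hlt⟩ := h.pred v hvx hv
      exact hc u a v hres (ih _ hlt u hu rfl)

/-! ### Correctness of the search -/

/-- The target expression is evaluated again after the label is written, which is why `hv'` is
needed. -/
theorem run_tryLabel {eu ev : Expr} {u v : ℕ} (hu : eu.eval σ = u) (hv : ev.eval σ = v)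
    (hv' : ev.eval (σ.setArr 3 v (σ.reg 2 + 2)) = v) :
    (tryLabel eu ev).run σ =
      if σ.arr 3 u ≠ 0 ∧ σ.arr 3 v = 0 ∧ σ.arr 3 u < σ.reg 2 + 2 then
        (σ.setArr 3 v (σ.reg 2 + 2)).setArr 4 v (σ.reg 1) else σ := by
  simp only [tryLabel, Code.run, Expr.eval, hu, hv, hv']
  by_cases h1 : σ.arr 3 u = 0
  · simp [h1]
  by_cases h2 : σ.arr 3 v = 0
  · by_cases h3 : σ.arr 3 u < σ.reg 2 + 2
    · have : σ.reg 2 + 2 - σ.arr 3 u ≠ 0 := by omega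
      simp [h1, h2, h3, this]
    · have : σ.reg 2 + 2 - σ.arr 3 u = 0 := by omega
      simp [h2, h3, this]
  · have : 1 - σ.arr 3 v = 0 := by omega
    simp [h2, this]

/-- The state of a round of the search after the first `i` arcs. -/
structure RoundInv (I : RoutingInstance) (cap : Bool) (F : Finset (Fin I.numArcs))
    (x : Fin I.numVertices) (r : ℕ) (lab₀ : ℕ → ℕ) (i : ℕ) (σ : State) : Prop where
  labels : I.Labels cap F x (r + 2) (σ.arr 3) (σ.arr 4)
  old : ∀ v : Fin I.numVertices, lab₀ v ≠ 0 → σ.arr 3 v = lab₀ v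
  done : ∀ u (a : Fin I.numArcs) v, a.val < i → I.Residual cap F u a v → lab₀ u ≠ 0 →
    σ.arr 3 v ≠ 0

theorem RoundInv.tryLabel {r : ℕ} {lab₀ : ℕ → ℕ} {a : Fin I.numArcs}
    (h : RoundInv I cap F x r lab₀ a σ) (h₀ : ∀ v : Fin I.numVertices, lab₀ v ≤ r + 1)
    (h2 : σ.reg 2 = r) (h1 : σ.reg 1 = a) {u v : Fin I.numVertices}
    (hres : I.Residual cap F u a v)
    (huniq : ∀ u' v', I.Residual cap F u' a v' → u' = u ∧ v' = v) {eu ev : Expr}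
    (hu : eu.eval σ = u) (hv : ev.eval σ = v)
    (hv' : ev.eval (σ.setArr 3 v (σ.reg 2 + 2)) = v) :
    RoundInv I cap F x r lab₀ (a + 1) ((tryLabel eu ev).run σ) := by
  rw [run_tryLabel hu hv hv', h2, h1]
  split
  case isTrue hcond =>
    refine ⟨?_, fun w hw => ?_, fun u' b w hb hres' hu' => ?_⟩
    · exact h.labels.extend hres hcond.1 hcond.2.2 hcond.2.1 (by simp) (by simp)
    · have := h.old w hw
      have hwv : (w : ℕ) ≠ v := by
        intro hwv
        rw [hwv, hcond.2.1] at this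
        rw [hwv] at hw
        exact hw this.symm
      simpa [hwv] using this
    · by_cases hwv : (w : ℕ) = v
      · simp [hwv]
      · have hba : b ≠ a := by
          rintro rfl
          exact hwv (congrArg Fin.val (huniq _ _ hres').2)
        have : b.val ≠ a.val := fun h => hba (Fin.ext h)
        simpa [hwv] using h.done u' b w (by omega) hres' hu'
  case isFalse hcond =>
    refine ⟨h.labels, h.old, fun u' b w hb hres' hu' => ?_⟩
    by_cases hba : b = a
    · subst hba
      obtain ⟨rfl, rfl⟩ := huniq _ _ hres'
      intro hw
      have h3 := h.old u' hu'
      have h4 := h₀ u'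
      -- A vertex labelled before the round has label at most `r + 1`, so an unlabelled `v` would
      -- have passed all tests.
      exact hcond ⟨by rwa [h3], hw, by omega⟩
    · have : b.val ≠ a.val := fun h => hba (Fin.ext h)
      exact h.done u' b w (by omega) hres' hu'

theorem RoundInv.relax {r i : ℕ} {lab₀ : ℕ → ℕ} (hσ : I.Ready σ)
    (h : RoundInv I cap (I.flowSet σ) x r lab₀ i σ)
    (h₀ : ∀ v : Fin I.numVertices, lab₀ v ≤ r + 1) (h2 : σ.reg 2 = r) (h1 : σ.reg 1 = i) :
    RoundInv I cap (I.flowSet σ) x r lab₀ (i + 1) ((relax cap).run σ) := by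
  simp only [RoutingInstance.relax, Code.run, Expr.eval, hσ.eval_numArcs, h1]
  by_cases hi : i < I.numArcs
  · rw [if_pos (by omega)]
    obtain ⟨a, rfl⟩ : ∃ a : Fin I.numArcs, i = a := ⟨⟨i, hi⟩, rfl⟩
    have hσ' : ∀ v : ℕ, I.Ready (σ.setArr 3 v (σ.reg 2 + 2)) := fun v => by
      refine hσ.congr rfl ?_
      funext j
      simp
    by_cases ha : σ.arr 2 a = 0
    · rw [if_neg (by simpa using ha)]
      have haF : a ∉ I.flowSet σ := by simpa using ha
      cases cap with
      | false =>
        refine ⟨h.labels, h.old, fun u b v hb hres hu => ?_⟩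
        have hba : b ≠ a := by
          rintro rfl
          rcases hres with ⟨h, -⟩ | ⟨h, -⟩
          · exact haF h
          · simp at h
        have : b.val ≠ a.val := fun h => hba (Fin.ext h)
        exact h.done u b v (by omega) hres hu
      | true =>
        refine h.tryLabel h₀ h2 h1 (.inr ⟨rfl, haF, rfl, rfl⟩) ?_ (hσ.eval_tail h1)
          (hσ.eval_head h1) ((hσ' _).eval_head h1)
        rintro u' v' (⟨h, -⟩ | ⟨-, -, rfl, rfl⟩)
        · exact absurd h haF
        · exact ⟨rfl, rfl⟩
    · rw [if_pos ha]
      have haF : a ∈ I.flowSet σ := by simpa using ha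
      refine h.tryLabel h₀ h2 h1 (.inl ⟨haF, rfl, rfl⟩) ?_ (hσ.eval_head h1)
          (hσ.eval_tail h1) ((hσ' _).eval_tail h1)
      rintro u' v' (⟨-, rfl, rfl⟩ | ⟨-, h, -⟩)
      · exact ⟨rfl, rfl⟩
      · exact absurd haF h
  · rw [if_neg (by omega)]
    exact ⟨h.labels, h.old, fun u b v _ hres hu => h.done u b v (by omega) hres hu⟩

theorem run_round {r : ℕ} (hσ : I.Ready σ) (h2 : σ.reg 2 = r)
    (h : I.Labels cap (I.flowSet σ) x (r + 1) (σ.arr 3) (σ.arr 4)) :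
    RoundInv I cap (I.flowSet σ) x r (σ.arr 3) I.numArcs
      ((Code.forTo 1 (relax cap)).run σ) := by
  have h0 : RoundInv I cap (I.flowSet σ) x r (σ.arr 3) (σ.reg 0)
      ((Code.forTo 1 (relax cap)).run σ) := by
    refine Code.run_forTo_induction
      (fun i τ => RoundInv I cap (I.flowSet σ) x r (σ.arr 3) i τ)
      (fun _ _ _ h => ⟨h.labels, h.old, h.done⟩) ?_ ?_
    · exact ⟨h.mono (by omega), fun _ _ => rfl, fun _ _ _ h => absurd h (by omega)⟩
    · intro i τ hi hreg harr h1 hinv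
      have e2 : τ.arr 2 = σ.arr 2 := harr 2 (by cases cap <;> simp [Code.arrs, relax, tryLabel])
      rw [← flowSet_congr e2] at hinv ⊢
      refine hinv.relax (hσ.congr ?_ ?_) h.le ?_ h1
      · exact hreg 0 (by cases cap <;> simp [Code.regs, relax, tryLabel])
      · exact harr 0 (by cases cap <;> simp [Code.arrs, relax, tryLabel])
      · rw [hreg 2 (by cases cap <;> simp [Code.regs, relax, tryLabel]), h2]
  refine ⟨h0.labels, h0.old, fun u a v ha => h0.done u a v ?_⟩
  rw [hσ.reg_zero, size]
  omega

-- After `r` rounds the labelled set is closed or has more than `r` elements; with `size + 1` rounds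
-- the latter is impossible.
open Finset in
theorem run_search (hσ : I.Ready σ) {ex : Expr} (hex : ∀ τ, I.Ready τ → ex.eval τ = x) :
    I.Labels cap (I.flowSet σ) x (I.size + 2) (((search ex cap).run σ).arr 3)
        (((search ex cap).run σ).arr 4) ∧
      I.ClosedLabels cap (I.flowSet σ) (((search ex cap).run σ).arr 3) := by
  simp only [search, Code.run.eq_4]
  set σ₁ := (Code.forTo 1 (.write 3 (.reg 1) (.const 0))).run σ with hσ₁
  have hr₁ : I.Ready σ₁ := hσ.run (by simp [Code.regs]) (by simp [Code.arrs])
  have hz : ∀ v : Fin I.numVertices, σ₁.arr 3 v = 0 := by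
    have : ∀ j < σ.reg 0, σ₁.arr 3 j = 0 := by
      refine Code.run_forTo_induction
        (fun i τ => ∀ j < i, τ.arr 3 j = 0) (fun _ _ _ h => h) (by simp) ?_
      intro i τ hi _ _ h1 hinv j hj
      simp only [Code.run, Expr.eval, h1, State.setArr_arr, true_and]
      split
      · rfl
      · exact hinv j (by omega)
    intro v
    refine this v ?_
    rw [hσ.reg_zero, size]
    omega
  have hF₁ : I.flowSet σ₁ = I.flowSet σ :=
    flowSet_congr (Code.run_arr _ _ _ (by simp [Code.arrs]))
  simp only [Code.run.eq_3, Expr.eval, hex _ hr₁]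
  set σ₂ := σ₁.setArr 3 x 1 with hσ₂
  have hr₂ : I.Ready σ₂ := by
    refine hr₁.congr rfl ?_
    funext j
    simp [hσ₂]
  have hF₂ : I.flowSet σ₂ = I.flowSet σ := by
    rw [← hF₁]
    refine flowSet_congr ?_
    funext j
    simp [hσ₂]
  rw [← hF₂]
  have key := Code.run_forTo_induction (r := 2) (P := .forTo 1 (relax cap)) (σ := σ₂)
    (fun r τ => I.Labels cap (I.flowSet σ₂) x (r + 1) (τ.arr 3) (τ.arr 4) ∧
      (I.ClosedLabels cap (I.flowSet σ₂) (τ.arr 3) ∨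
        r < #{v : Fin I.numVertices | τ.arr 3 v ≠ 0})) (fun _ _ _ h => h) ?_ ?_
  · rw [hr₂.reg_zero] at key
    refine ⟨key.1, key.2.resolve_right ?_⟩
    have := card_le_univ
      {v : Fin I.numVertices | ((Code.forTo 2 (.forTo 1 (relax cap))).run σ₂).arr 3 v ≠ 0}
    rw [Fintype.card_fin] at this
    rw [size]
    omega
  · have hv : ∀ v : Fin I.numVertices, v ≠ x → σ₂.arr 3 v = 0 := fun v hv => by
      have : (v : ℕ) ≠ x := fun h => hv (Fin.ext h)
      simp [hσ₂, this, hz]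
    have hx : σ₂.arr 3 x = 1 := by simp [hσ₂]
    refine ⟨⟨hx, fun v => ?_, fun v hvx h => absurd (hv v hvx) h⟩, .inr ?_⟩
    · by_cases hvx : v = x
      · rw [hvx, hx]
      · simp [hv v hvx]
    · exact card_pos.2 ⟨x, by simp [hx]⟩
  · intro r τ hr hreg harr h2 ⟨hL, hC⟩
    have e2 : τ.arr 2 = σ₂.arr 2 := harr 2 (by cases cap <;> simp [Code.arrs, relax, tryLabel])
    rw [← flowSet_congr e2] at hL hC ⊢
    have hτ : I.Ready τ := by
      refine hr₂.congr ?_ ?_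
      · exact hreg 0 (by cases cap <;> simp [Code.regs, relax, tryLabel])
      · exact harr 0 (by cases cap <;> simp [Code.arrs, relax, tryLabel])
    have hround := run_round hτ h2 hL
    set τ' := (Code.forTo 1 (relax cap)).run τ
    have hmono : ∀ v : Fin I.numVertices, τ.arr 3 v ≠ 0 → τ'.arr 3 v ≠ 0 := fun v hv => by
      rwa [hround.old v hv]
    have hsub : (univ.filter fun v : Fin I.numVertices => τ.arr 3 v ≠ 0) ⊆
        univ.filter fun v : Fin I.numVertices => τ'.arr 3 v ≠ 0 := fun v hv => by
      simp only [mem_filter, mem_univ, true_and] at hv ⊢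
      exact hmono v hv
    -- If no vertex is new, every labelled vertex was already labelled at the start of the round, so
    -- all its residual arcs have been handled.
    have hclosed : (∀ v : Fin I.numVertices, τ'.arr 3 v ≠ 0 → τ.arr 3 v ≠ 0) →
        I.ClosedLabels cap (I.flowSet τ) (τ'.arr 3) := fun h u a v hres hu =>
      hround.done u a v a.2 hres (h u hu)
    refine ⟨hround.labels, ?_⟩
    rcases hC with hC | hC
    · exact .inl (hclosed (hround.labels.subset_of_closed (by rw [hL.root]; simp) hC))
    · by_cases hex : ∀ v : Fin I.numVertices, τ'.arr 3 v ≠ 0 → τ.arr 3 v ≠ 0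
      · exact .inl (hclosed hex)
      · push Not at hex
        obtain ⟨v, hv, hv'⟩ := hex
        have : #{v : Fin I.numVertices | τ.arr 3 v ≠ 0} <
            #{v : Fin I.numVertices | τ'.arr 3 v ≠ 0} :=
          card_lt_card ((ssubset_iff_of_subset hsub).2 ⟨v, by simpa using hv, by simpa using hv'⟩)
        exact .inr (by omega)

end RoutingInstance

namespace RoutingInstance

open RAM

variable {I : RoutingInstance} {σ : State} {cap : Bool} {F : Finset (Fin I.numArcs)}
  {x y : Fin I.numVertices} {R : ℕ} {lab par : ℕ → ℕ}

/-! ### Correctness of the walk along the search tree -/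

/-- The walk has followed the arcs `p` from `y` to `v`; it has started with the flow `F`, the output
array `out` and the output position `pos`. -/
structure WalkInv (I : RoutingInstance) (cap : Bool) (F : Finset (Fin I.numArcs))
    (y : Fin I.numVertices) (lab out : ℕ → ℕ) (pos : ℕ) (v : Fin I.numVertices)
    (p : List (Fin I.numArcs)) (τ : State) : Prop where
  vertex : τ.reg 5 = v
  labelled : lab v ≠ 0
  netOut : ∀ w, I.graph.netOut (I.flowSet τ) w =
    I.graph.netOut F w + ((if v = w then 1 else 0) - (if y = w then 1 else 0))
  changed : ∀ a, (a ∈ I.flowSet τ ↔ a ∈ F) ∨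
    ∃ (u w : Fin I.numVertices), lab v < lab w ∧ I.Residual cap F u a w
  position : τ.reg 6 = pos + p.length
  before : ∀ j < pos, τ.arr 1 j = out j
  written : ∀ j (h : j < p.length), τ.arr 1 (pos + j) = p[j]
  isWalk : cap = false → I.graph.IsWalk y p v
  decreasing : cap = false →
    (y :: p.map I.graph.head).Pairwise fun a b : Fin I.numVertices => lab b < lab a
  le : cap = false → ∀ w ∈ y :: p.map I.graph.head, lab v ≤ lab (w : Fin I.numVertices)
  subset : cap = false → ∀ a ∈ p, a ∈ F
  removed : cap = false → ∀ a, a ∈ I.flowSet τ ↔ a ∈ F ∧ a ∉ p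

theorem run_walkStep_root (hL : I.Labels cap F x R (σ.arr 3) par) (h5 : σ.reg 5 = x) :
    walkStep.run σ = σ := by
  simp [walkStep, Expr.eval, h5, hL.root]

theorem WalkInv.step {out : ℕ → ℕ} {pos : ℕ} {v : Fin I.numVertices} {p : List (Fin I.numArcs)}
    (hσ : I.Ready σ) (hL : I.Labels cap F x R (σ.arr 3) (σ.arr 4)) (hvx : v ≠ x)
    (h : WalkInv I cap F y (σ.arr 3) out pos v p σ) :
    ∃ (u : Fin I.numVertices) (q : List (Fin I.numArcs)), σ.arr 3 u < σ.arr 3 v ∧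
      WalkInv I cap F y (σ.arr 3) out pos u q (walkStep.run σ) := by
  obtain ⟨u, a, hpar, hres, hu, huv⟩ := hL.pred v hvx h.labelled
  -- Inverted arcs have targets with labels above that of `v`, while `a` has target `v`; so `a` is
  -- still in its original state.
  have haF : a ∈ I.flowSet σ ↔ a ∈ F := by
    rcases h.changed a with h1 | ⟨u', w, hlt, hres'⟩
    · exact h1
    · rw [hres'.target_unique hres] at hlt
      exact absurd hlt (lt_irrefl _)
  have hlab : σ.arr 3 v - 1 ≠ 0 := by omega
  set σ₁ := ((σ.setReg 9 a).setArr 1 (σ.reg 6) a).setReg 6 (σ.reg 6 + 1) with hσ₁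
  have hrun : walkStep.run σ = if σ.arr 2 a ≠ 0 then
      (σ₁.setArr 2 a 0).setReg 5 ((headExpr (.reg 9)).eval (σ₁.setArr 2 a 0)) else
      (σ₁.setArr 2 a 1).setReg 5 ((tailExpr (.reg 9)).eval (σ₁.setArr 2 a 1)) := by
    simp [walkStep, Expr.eval, h.vertex, hlab, hpar, hσ₁]
  have hr : ∀ k, I.Ready (σ₁.setArr 2 a k) := fun k =>
    hσ.congr (by simp [hσ₁]) (by funext j; simp [hσ₁])
  have h9 : ∀ k, (Expr.reg 9).eval (σ₁.setArr 2 a k) = a := fun k => by simp [Expr.eval, hσ₁]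
  rw [(hr 0).eval_head (h9 0), (hr 1).eval_tail (h9 1)] at hrun
  refine ⟨u, p ++ [a], huv, ?_⟩
  obtain ⟨k, hk⟩ : ∃ k, walkStep.run σ = (σ₁.setArr 2 a k).setReg 5 u ∧
      (k = 0 ↔ a ∈ F) := by
    rcases hres with ⟨h1, h2, h3⟩ | ⟨-, h1, h2, h3⟩
    · refine ⟨0, ?_, by simp [h1]⟩
      rw [hrun, if_pos (by simpa using haF.2 h1), h2]
    · refine ⟨1, ?_, by simp [h1]⟩
      rw [hrun, if_neg (fun hne => h1 (haF.1 (by simpa using hne))), h2]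
  obtain ⟨hk, hkF⟩ := hk
  have hflow : ∀ b, b ∈ I.flowSet (walkStep.run σ) ↔ if b = a then a ∉ F else b ∈ I.flowSet σ := by
    intro b
    by_cases hb : b = a
    · subst hb
      simp [hk, hkF]
    · have : (b : ℕ) ≠ a := fun h => hb (Fin.ext h)
      simp [hk, hσ₁, hb, this]
  have hcap : cap = false → a ∈ F ∧ I.graph.head a = u ∧ I.graph.tail a = v := by
    rintro rfl
    simpa [Residual] using hres
  refine ⟨by simp [hk], hu, fun w => ?_, fun b => ?_, ?_, fun j hj => ?_, fun j hj => ?_,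
    fun hc => ?_, fun hc => ?_, fun hc => ?_, fun hc => ?_, fun hc b => ?_⟩
  · rcases hres with ⟨h1, rfl, rfl⟩ | ⟨-, h1, rfl, rfl⟩
    · have : I.flowSet (walkStep.run σ) = (I.flowSet σ).erase a := by
        ext b
        rw [hflow, Finset.mem_erase]
        split <;> simp_all
      rw [this, DirGraph.netOut_erase _ (haF.2 h1), h.netOut w]
      simp only [eq_comm (b := w)]
      ring
    · have : I.flowSet (walkStep.run σ) = insert a (I.flowSet σ) := by
        ext b
        rw [hflow, Finset.mem_insert]
        split <;> simp_all
      rw [this, DirGraph.netOut_insert _ (fun h => h1 (haF.1 h)), h.netOut w]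
      ring
  · by_cases hb : b = a
    · exact .inr ⟨u, v, huv, hb ▸ hres⟩
    · rcases h.changed b with h1 | ⟨u', w, hlt, hres'⟩
      · exact .inl (by rw [hflow, if_neg hb, h1])
      · exact .inr ⟨u', w, huv.trans hlt, hres'⟩
  · simp [hk, hσ₁, h.position]
    omega
  · have : j ≠ σ.reg 6 := by rw [h.position]; omega
    simp [hk, hσ₁, this, h.before j hj]
  · by_cases hjp : j < p.length
    · have : pos + j ≠ σ.reg 6 := by rw [h.position]; omega
      simp [hk, hσ₁, this, h.written j hjp, List.getElem_append_left, hjp]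
    · have hj' : j = p.length := by
        simp only [List.length_append, List.length_singleton] at hj
        omega
      subst hj'
      simp [hk, hσ₁, h.position]
  · obtain ⟨-, h2, h3⟩ := hcap hc
    rw [← h2]
    exact DirGraph.IsWalk.concat (h3 ▸ h.isWalk hc)
  · obtain ⟨-, h2, -⟩ := hcap hc
    rw [List.map_append, ← List.cons_append, List.pairwise_append]
    refine ⟨h.decreasing hc, by simp, fun w hw w' hw' => ?_⟩
    obtain rfl : w' = u := by simpa [h2] using hw'
    exact huv.trans_le (h.le hc w hw)
  · obtain ⟨-, h2, -⟩ := hcap hc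
    intro w hw
    rw [List.map_append, ← List.cons_append, List.mem_append] at hw
    rcases hw with hw | hw
    · exact huv.le.trans (h.le hc w hw)
    · obtain rfl : w = u := by simpa [h2] using hw
      exact le_rfl
  · intro b hb
    rcases List.mem_append.1 hb with hb | hb
    · exact h.subset hc b hb
    · rw [List.mem_singleton.1 hb]
      exact (hcap hc).1
  · rw [hflow, h.removed hc b]
    have := (hcap hc).1
    by_cases hb : b = a <;> simp [hb, this]

/-- The change of net outflow serves both uses: from sink to source it raises the flow value by one,
from source to sink it lowers it by one. Without unused arcs the tree path, read from `y`, follows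
flow arcs forwards, so it is a directed path and inverting removes it. -/
theorem run_walk (hσ : I.Ready σ) {ey : Expr} (hey : ey.eval σ = y) (hR : R ≤ I.size + 2)
    (hL : I.Labels cap (I.flowSet σ) x R (σ.arr 3) (σ.arr 4)) (hy : σ.arr 3 y ≠ 0) :
    (∀ w, I.graph.netOut (I.flowSet ((walk ey).run σ)) w = I.graph.netOut (I.flowSet σ) w +
        ((if x = w then 1 else 0) - (if y = w then 1 else 0))) ∧
      ∃ p : List (Fin I.numArcs), ((walk ey).run σ).reg 6 = σ.reg 6 + 1 + p.length ∧
        (∀ j < σ.reg 6, ((walk ey).run σ).arr 1 j = σ.arr 1 j) ∧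
        ((walk ey).run σ).arr 1 (σ.reg 6) = p.length ∧
        (∀ j (h : j < p.length), ((walk ey).run σ).arr 1 (σ.reg 6 + 1 + j) = p[j]) ∧
        (cap = false → I.graph.IsPath y p x ∧ (∀ a ∈ p, a ∈ I.flowSet σ) ∧
          ∀ a, a ∈ I.flowSet ((walk ey).run σ) ↔ a ∈ I.flowSet σ ∧ a ∉ p) := by
  set σ₁ := ((σ.setReg 5 y).setReg 7 (σ.reg 6)).setReg 6 (σ.reg 6 + 1) with hσ₁
  have hrun : (walk ey).run σ = ((Code.forTo 2 walkStep).run σ₁).setArr 1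
      (((Code.forTo 2 walkStep).run σ₁).reg 7) (((Code.forTo 2 walkStep).run σ₁).reg 6 -
        ((Code.forTo 2 walkStep).run σ₁).reg 7 - 1) := by
    simp [walk, Expr.eval, hey, hσ₁, -Code.run.eq_6]
  have hr₁ : I.Ready σ₁ := hσ.congr (by simp [hσ₁]) rfl
  -- Labels drop in every round. After `size + 1` rounds a label that began at most at `size + 2`
  -- would be at most 1, whereas a labelled non-root has label at least 2.
  have key := Code.run_forTo_induction (r := 2) (P := walkStep) (σ := σ₁)
    (fun i τ => ∃ (v : Fin I.numVertices) (p : List (Fin I.numArcs)),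
      (v = x ∨ σ.arr 3 v + i ≤ σ.arr 3 y) ∧
        WalkInv I cap (I.flowSet σ) y (σ.arr 3) (σ.arr 1) (σ.reg 6 + 1) v p τ) ?_ ?_ ?_
  · rw [hr₁.reg_zero] at key
    set τ := (Code.forTo 2 walkStep).run σ₁ with hτ
    obtain ⟨v, p, hv, hw⟩ := key
    have hvx : v = x := by
      by_contra hvx
      obtain ⟨u, a, -, -, hu, hlt⟩ := hL.pred v hvx hw.labelled
      have h1 := hv.resolve_left hvx
      have h2 := hL.le y
      omega
    subst hvx
    have h7 : τ.reg 7 = σ.reg 6 := by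
      rw [hτ, Code.run_reg _ _ _ (by simp [Code.regs, walkStep])]
      simp [hσ₁]
    have hF : I.flowSet ((walk ey).run σ) = I.flowSet τ := by
      rw [hrun]
      refine flowSet_congr ?_
      funext j
      simp
    have h6 := hw.position
    rw [hF, hrun, h7]
    refine ⟨hw.netOut, p, h6, fun j hj => ?_, ?_, fun j hj => ?_, fun hc => ⟨⟨hw.isWalk hc, ?_⟩,
      hw.subset hc, hw.removed hc⟩⟩
    · have : j ≠ σ.reg 6 := by omega
      simpa [this] using hw.before j (by omega)
    · simp only [State.setArr_arr, true_and, if_true]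
      omega
    · have : σ.reg 6 + 1 + j ≠ σ.reg 6 := by omega
      simpa [this] using hw.written j hj
    -- Strictly decreasing labels exclude repeated vertices.
    · refine (hw.decreasing hc).imp ?_
      rintro a _ hlt rfl
      exact lt_irrefl _ hlt
  · rintro i τ k ⟨v, p, h1, h2⟩
    exact ⟨v, p, h1, ⟨by simp [h2.vertex], h2.2, h2.3, h2.4, by simp [h2.position], h2.6, h2.7, h2.8,
      h2.9, h2.10, h2.11, h2.12⟩⟩
  · have hF : I.flowSet σ₁ = I.flowSet σ := flowSet_congr rfl
    exact ⟨y, [], .inr (by simp), ⟨by simp [hσ₁], hy, by simp [hF], by simp [hF], by simp [hσ₁],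
      fun _ _ => rfl, by simp, fun _ => rfl, by simp, by simp, by simp, by simp [hF]⟩⟩
  · rintro i τ hi hreg harr h2 ⟨v, p, hv, hw⟩
    have hτ : I.Ready τ := hr₁.congr (hreg 0 (by simp [Code.regs, walkStep]))
      (harr 0 (by simp [Code.arrs, walkStep]))
    have h3 : τ.arr 3 = σ.arr 3 := harr 3 (by simp [Code.arrs, walkStep])
    have h4 : τ.arr 4 = σ.arr 4 := harr 4 (by simp [Code.arrs, walkStep])
    rw [← h3] at hv hw ⊢
    rw [← h3, ← h4] at hL
    by_cases hvx : v = x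
    · rw [run_walkStep_root hL (hvx ▸ hw.vertex)]
      exact ⟨v, p, .inl hvx, hw⟩
    · obtain ⟨u, q, hlt, hw'⟩ := hw.step hτ hL hvx
      have := hv.resolve_left hvx
      exact ⟨u, q, .inr (by omega), hw'⟩

end RoutingInstance

namespace RoutingInstance

open RAM

variable {I : RoutingInstance} {σ : State}

/-! ### Maximum flow -/

theorem run_search_frame (e : Expr) (cap : Bool) (σ : State) :
    ((search e cap).run σ).arr 1 = σ.arr 1 ∧ ((search e cap).run σ).arr 2 = σ.arr 2 ∧
      ((search e cap).run σ).reg 6 = σ.reg 6 ∧ ((search e cap).run σ).reg 8 = σ.reg 8 := by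
  refine ⟨Code.run_arr _ _ _ ?_, Code.run_arr _ _ _ ?_, Code.run_reg _ _ _ ?_,
    Code.run_reg _ _ _ ?_⟩ <;> cases cap <;> simp [Code.regs, Code.arrs, search, relax, tryLabel]

theorem Ready.run_search (h : I.Ready σ) (e : Expr) (cap : Bool) :
    I.Ready ((search e cap).run σ) := by
  refine h.run ?_ ?_ <;> cases cap <;> simp [Code.regs, Code.arrs, search, relax, tryLabel]

/-- After `i` rounds the value is at least `i`, or some cut is tight. The first alternative fails at
the end, as the value is at most the number of arcs. -/
theorem run_maxFlow (hσ : I.Ready σ) (h2 : ∀ j, σ.arr 2 j = 0) (h8 : σ.reg 8 = 0) :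
    I.graph.IsUnitFlow I.source I.sink (I.flowSet (maxFlow.run σ)) ((maxFlow.run σ).reg 8) ∧
      ∃ U, I.graph.IsMinCut I.source I.sink U ∧
        (I.graph.outArcs U).ncard = (maxFlow.run σ).reg 8 := by
  have key : I.graph.IsUnitFlow I.source I.sink (I.flowSet (maxFlow.run σ))
      ((maxFlow.run σ).reg 8) ∧ (σ.reg 0 ≤ (maxFlow.run σ).reg 8 ∨
        ∃ U, I.source ∈ U ∧ I.sink ∉ U ∧ (maxFlow.run σ).reg 8 = (I.graph.outArcs U).ncard) := by
    refine Code.run_forTo_induction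
      (fun i τ => I.graph.IsUnitFlow I.source I.sink (I.flowSet τ) (τ.reg 8) ∧ (i ≤ τ.reg 8 ∨
        ∃ U, I.source ∈ U ∧ I.sink ∉ U ∧ τ.reg 8 = (I.graph.outArcs U).ncard)) ?_ ?_ ?_
    · intro i τ v h
      have hF : I.flowSet (τ.setReg 3 v) = I.flowSet τ := rfl
      simpa [hF] using h
    · have : I.flowSet σ = ∅ := by simp [flowSet, h2]
      refine ⟨fun v => ?_, .inl (Nat.zero_le _)⟩
      simp [this, h8, DirGraph.netOut]
    · rintro i τ - hreg harr - ⟨hflow, hi⟩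
      have hτ : I.Ready τ := hσ.congr
        (hreg 0 (by simp [Code.regs, search, relax, tryLabel, walk, walkStep]))
        (harr 0 (by simp [Code.arrs, search, relax, tryLabel, walk, walkStep]))
      obtain ⟨-, e2, -, e8⟩ := run_search_frame sourceExpr true τ
      obtain ⟨hL, hC⟩ := run_search (cap := true) hτ (ex := sourceExpr)
        (fun _ h => h.eval_source)
      have hτ₁ := hτ.run_search sourceExpr true
      have hrun : (Code.seq (search sourceExpr true) (.cond (.read 3 sinkExpr)
          (.seq (walk sinkExpr) (.assign 8 (.add (.reg 8) (.const 1)))) .skip)).run τ =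
          if ((search sourceExpr true).run τ).arr 3 I.sink ≠ 0 then
            ((walk sinkExpr).run ((search sourceExpr true).run τ)).setReg 8
              (((walk sinkExpr).run ((search sourceExpr true).run τ)).reg 8 + 1)
          else (search sourceExpr true).run τ := by
        rw [← hτ₁.eval_sink]
        rfl
      rw [hrun]
      set τ₁ := (search sourceExpr true).run τ
      rw [← flowSet_congr e2] at hflow hL hC
      rw [← e8] at hi hflow
      split
      case isTrue ht =>
        obtain ⟨hw, -⟩ := run_walk hτ₁ hτ₁.eval_sink le_rfl hL ht
        have w8 : ((walk sinkExpr).run τ₁).reg 8 = τ₁.reg 8 :=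
          Code.run_reg _ _ _ (by simp [Code.regs, walk, walkStep])
        have hflow' : I.graph.IsUnitFlow I.source I.sink (I.flowSet ((walk sinkExpr).run τ₁))
            (τ₁.reg 8 + 1) := fun v => by
          rw [hw v, hflow v]
          ring
        have hF : I.flowSet (((walk sinkExpr).run τ₁).setReg 8 (τ₁.reg 8 + 1)) =
            I.flowSet ((walk sinkExpr).run τ₁) := rfl
        rw [w8, hF]
        refine ⟨by simpa using hflow', .inl ?_⟩
        rcases hi with hi | ⟨U, hs, ht, hU⟩
        · simpa using hi
        -- Once a cut is tight, a further augmentation would violate weak duality.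
        · have := hflow'.value_le hs ht
          omega
      case isFalse ht =>
        refine ⟨hflow, .inr ⟨{v | τ₁.arr 3 v ≠ 0}, ?_, by simpa using ht, ?_⟩⟩
        · simp [hL.root]
        -- The labelled set is closed under residual arcs: unused arcs do not leave it and flow arcs
        -- do not enter it.
        · have := hflow.value_eq_ncard (U := {v | τ₁.arr 3 v ≠ 0}) (by simp [hL.root])
            (by simpa using ht)
            (fun a ha haF => hC _ a _ (.inr ⟨rfl, haF, rfl, rfl⟩) ha)
            (fun a haF ha => hC _ a _ (.inl ⟨haF, rfl, rfl⟩) ha)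
          exact_mod_cast this
  obtain ⟨hflow, hN | ⟨U, hs, ht, hU⟩⟩ := key
  · have h1 := hflow.value_le (U := {I.source}) rfl (fun h => I.source_ne_sink (Eq.symm h))
    have h2 := Set.ncard_le_card (I.graph.outArcs {I.source})
    rw [Nat.card_fin] at h2
    rw [hσ.reg_zero, size] at hN
    omega
  · exact ⟨hflow, U, hflow.isMinCut hs ht (by exact_mod_cast hU), hU.symm⟩

/-! ### Path decomposition -/

variable (I) in
/-- The output of a player who uses the path `p`. -/
def block (p : I.graph.PathFromTo I.source I.sink) : List ℕ := p.1.length :: p.1.map Fin.val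

theorem outputs_append {l l' : List ℕ} :
    σ.Outputs (l ++ l') ↔
      σ.Outputs l ∧ ∀ i, ∀ h : i < l'.length, σ.arr 1 (l.length + i) = l'[i] := by
  refine ⟨fun h => ⟨fun i hi => ?_, fun i hi => ?_⟩, fun h i hi => ?_⟩
  · rw [h i (by simp; omega), List.getElem_append_left hi]
  · rw [h _ (by simp; omega), List.getElem_append_right (by omega)]
    simp
  · by_cases hil : i < l.length
    · rw [List.getElem_append_left hil, h.1 i hil]
    · rw [List.getElem_append_right (by omega), ← h.2]
      congr 1
      omega

/-- If the flow has positive value, then the sink can be traced back to the source. -/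
theorem label_source_ne_zero {F : Finset (Fin I.numArcs)} {k : ℤ} {R : ℕ} {lab par : ℕ → ℕ}
    (h : I.graph.IsUnitFlow I.source I.sink F k) (hk : 0 < k)
    (hL : I.Labels false F I.sink R lab par) (hC : I.ClosedLabels false F lab) :
    lab I.source ≠ 0 := by
  classical
  intro hs
  -- No flow arc leaves the unlabelled set: a labelled head forces a labelled tail.
  have h1 := h.value_eq (U := {v | lab v = 0}) hs (by simp [hL.root])
  have h2 : k ≤ 0 := by
    rw [h1]
    refine Finset.sum_nonpos fun a ha => ?_
    have := hC _ a _ (.inl ⟨ha, rfl, rfl⟩)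
    by_cases h3 : lab (I.graph.tail a) = 0 <;> by_cases h4 : lab (I.graph.head a) = 0 <;>
      simp_all
  omega

/-- The extracted paths avoid the remaining flow, whose value is the number of paths still to be
found; hence later paths are disjoint from earlier ones. Flow cycles may remain and do no harm. -/
theorem run_extractPaths (hσ : I.Ready σ) {m : ℕ}
    (hflow : I.graph.IsUnitFlow I.source I.sink (I.flowSet σ) m) (h8 : σ.reg 8 = m)
    (hm : m ≤ I.size + 1) :
    ∃ Q : ℕ → I.graph.PathFromTo I.source I.sink,
      (∀ j l, j < l → l < m → List.Disjoint (Q j).1 (Q l).1) ∧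
      (extractPaths.run σ).Outputs ((List.range m).flatMap fun j => I.block (Q j)) ∧
      (extractPaths.run σ).reg 6 = ((List.range m).flatMap fun j => I.block (Q j)).length := by
  set σ₁ := σ.setReg 6 0 with hσ₁
  have hr₁ : I.Ready σ₁ := hσ.congr (by simp [hσ₁]) rfl
  have h8₁ : σ₁.reg 8 = m := by simp [hσ₁, h8]
  have hrun : extractPaths.run σ = (Code.forTo 3 (.cond (.sub (.reg 8) (.reg 3))
    (.seq (search sinkExpr false) (walk sourceExpr)) .skip)).run σ₁ := rfl
  have key := Code.run_forTo_induction (r := 3) (P := .cond (.sub (.reg 8) (.reg 3))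
      (.seq (search sinkExpr false) (walk sourceExpr)) .skip) (σ := σ₁)
    (fun i τ => ∃ Q : ℕ → I.graph.PathFromTo I.source I.sink,
      (∀ j l, j < l → l < min i m → List.Disjoint (Q j).1 (Q l).1) ∧
      (∀ j < min i m, ∀ a ∈ (Q j).1, a ∉ I.flowSet τ) ∧
      I.graph.IsUnitFlow I.source I.sink (I.flowSet τ) (m - min i m : ℕ) ∧
      τ.Outputs ((List.range (min i m)).flatMap fun j => I.block (Q j)) ∧
      τ.reg 6 = ((List.range (min i m)).flatMap fun j => I.block (Q j)).length) ?_ ?_ ?_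
  · rw [hr₁.reg_zero, min_eq_right hm, ← hrun] at key
    obtain ⟨Q, h1, -, -, h2, h3⟩ := key
    exact ⟨Q, h1, h2, h3⟩
  · rintro i τ v ⟨Q, h1, h2, h3, h4, h5⟩
    exact ⟨Q, h1, h2, h3, h4, by simpa using h5⟩
  -- An arbitrary path serves as the default value of `Q` at indices not yet extracted.
  · obtain ⟨p, hp⟩ := I.exists_path
    refine ⟨fun _ => ⟨p, hp⟩, by simp, by simp, ?_, ?_, ?_⟩
    · have hF : I.flowSet σ₁ = I.flowSet σ := rfl
      simpa [hF] using hflow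
    · simp [State.Outputs]
    · simp [hσ₁]
  · rintro i τ - hreg harr h3 ⟨Q, hdisj, hQ, hfl, hout, hpos⟩
    have hτ : I.Ready τ := hr₁.congr
      (hreg 0 (by simp [Code.regs, search, relax, tryLabel, walk, walkStep]))
      (harr 0 (by simp [Code.arrs, search, relax, tryLabel, walk, walkStep]))
    have h8τ : τ.reg 8 = m := by
      rw [hreg 8 (by simp [Code.regs, search, relax, tryLabel, walk, walkStep]), h8₁]
    simp only [Code.run.eq_5, Code.run.eq_4, Code.run.eq_1, Expr.eval, h8τ, h3]
    by_cases hi : i < m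
    case neg =>
      rw [if_neg (by omega)]
      have e : min (i + 1) m = min i m := by omega
      rw [e]
      exact ⟨Q, hdisj, hQ, hfl, hout, hpos⟩
    rw [if_pos (by omega)]
    have e1 : min i m = i := by omega
    have e2 : min (i + 1) m = i + 1 := by omega
    rw [e1] at hdisj hQ hfl hout hpos
    rw [e2]
    obtain ⟨s1, s2, s6, -⟩ := run_search_frame sinkExpr false τ
    obtain ⟨hL, hC⟩ := run_search (cap := false) hτ (ex := sinkExpr) (fun _ h => h.eval_sink)
    have hτ₁ := hτ.run_search sinkExpr false
    set τ₁ := (search sinkExpr false).run τ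
    have hs := label_source_ne_zero hfl (by omega) hL hC
    rw [← flowSet_congr s2] at hL hQ hfl
    obtain ⟨hw, p, hp6, hpb, hpl, hpw, hp⟩ := run_walk hτ₁ hτ₁.eval_source le_rfl hL hs
    obtain ⟨hpath, hpF, hprem⟩ := hp rfl
    set τ₂ := (walk sourceExpr).run τ₁
    have hword : ((List.range (i + 1)).flatMap fun j => I.block (Function.update Q i ⟨p, hpath⟩ j)) =
        ((List.range i).flatMap fun j => I.block (Q j)) ++ (p.length :: p.map Fin.val) := by
      rw [List.range_succ, List.flatMap_append]
      congr 1
      · refine List.flatMap_congr fun j hj => ?_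
        rw [Function.update_of_ne (by simp at hj; omega)]
      · simp [block]
    refine ⟨Function.update Q i ⟨p, hpath⟩, fun j l hjl hl => ?_, fun j hj a ha => ?_,
      fun v => ?_, ?_, ?_⟩
    · rw [Function.update_of_ne (by omega : j ≠ i)]
      by_cases hli : l = i
      · subst hli
        rw [Function.update_self]
        exact fun a ha hap => hQ j hjl a ha (hpF a hap)
      · rw [Function.update_of_ne hli]
        exact hdisj j l hjl (by omega)
    · rw [hprem]
      by_cases hji : j = i
      · subst hji
        rw [Function.update_self] at ha
        exact fun h => h.2 ha
      · rw [Function.update_of_ne hji] at ha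
        exact fun h => hQ j (by omega) a ha h.1
    · rw [hw v, hfl v]
      have : ((m - i : ℕ) : ℤ) = (m - (i + 1) : ℕ) + 1 := by omega
      rw [this]
      ring
    · rw [hword, outputs_append]
      rw [s6, hpos] at hpb hpl hpw
      refine ⟨fun j hj => ?_, fun j hj => ?_⟩
      · rw [hpb j hj, s1]
        exact hout j hj
      · cases j with
        | zero => exact hpl
        | succ j =>
          have := hpw j (by simpa using hj)
          rw [show ∀ L : ℕ, L + (j + 1) = L + 1 + j by omega, this]
          simp
    · rw [hword, hp6, s6, hpos]
      simp
      omega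

/-! ### Cyclic repetition of the output -/

/-- `c` cells have been appended by copying the cells `L` places before them. -/
def RepeatInv (L : ℕ) (out : ℕ → ℕ) (c : ℕ) (τ : State) : Prop :=
  τ.reg 6 = L + c ∧ (∀ j < L, τ.arr 1 j = out j) ∧ ∀ j < c, τ.arr 1 (L + j) = τ.arr 1 j

theorem run_repeatOutput (hL : 0 < σ.reg 6) :
    (∀ j < σ.reg 6, (repeatOutput.run σ).arr 1 j = σ.arr 1 j) ∧
      ∀ j < σ.reg 0 * σ.reg 0,
        (repeatOutput.run σ).arr 1 (σ.reg 6 + j) = (repeatOutput.run σ).arr 1 j := by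
  set L := σ.reg 6 with hLdef
  set N := σ.reg 0 with hN
  set body : Code := .seq (.write 1 (.reg 6) (.read 1 (.sub (.reg 6) (.reg 10))))
    (.assign 6 (.add (.reg 6) (.const 1))) with hbody
  set σ₁ := σ.setReg 10 L with hσ₁
  have hrun : repeatOutput.run σ = (Code.forTo 3 (.forTo 4 body)).run σ₁ := rfl
  have hset : ∀ c τ r v, r ≠ 6 → RepeatInv L (σ.arr 1) c τ →
      RepeatInv L (σ.arr 1) c (τ.setReg r v) := fun c τ r v hr h =>
    ⟨by simpa [Ne.symm hr] using h.1, h.2⟩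
  have hstep : ∀ c τ, τ.reg 10 = L → RepeatInv L (σ.arr 1) c τ →
      RepeatInv L (σ.arr 1) (c + 1) (body.run τ) := by
    rintro c τ h10 ⟨h6, h1, h2⟩
    refine ⟨?_, fun j hj => ?_, fun j hj => ?_⟩
    · simp [hbody, Expr.eval, h6, add_assoc]
    · have : j ≠ L + c := by omega
      simp [hbody, Expr.eval, h6, h10, this, h1 j hj]
    · have h3 : j ≠ L + c := by omega
      by_cases hjc : j = c
      · subst hjc
        -- Since `L > 0`, the copied cell `c` differs from the written cell `L + c`.
        simp [hbody, Expr.eval, h6, h10, hL.ne']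
      · simp [hbody, Expr.eval, h6, h10, h3, hjc, h2 j (by omega)]
  have key : RepeatInv L (σ.arr 1) (σ₁.reg 0 * N) (repeatOutput.run σ) := by
    rw [hrun]
    refine Code.run_forTo_induction (fun i τ => RepeatInv L (σ.arr 1) (i * N) τ)
      (fun _ _ _ h => hset _ _ _ _ (by simp) h) ?_ ?_
    · exact ⟨by simp [hσ₁, hLdef], fun _ _ => rfl, by simp⟩
    · intro i τ _ hreg _ _ hinv
      have h0 : τ.reg 0 = N := by
        rw [hreg 0 (by simp [Code.regs, hbody])]
        simp [hσ₁, hN]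
      have h10 : τ.reg 10 = L := by
        rw [hreg 10 (by simp [Code.regs, hbody])]
        simp [hσ₁]
      have := Code.run_forTo_induction (r := 4) (P := body) (σ := τ)
        (fun j ρ => RepeatInv L (σ.arr 1) (i * N + j) ρ)
        (fun _ _ _ h => hset _ _ _ _ (by simp) h) hinv
        (fun j ρ _ hreg' _ _ h => hstep _ ρ
          (by rw [hreg' 10 (by simp [Code.regs, hbody]), h10]) h)
      rwa [h0, ← Nat.succ_mul] at this
  have h0 : σ₁.reg 0 = N := by simp [hσ₁, hN]
  rw [h0] at key
  exact ⟨key.2.1, key.2.2⟩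

/-- For `n ≤ m` the word is a prefix. Otherwise split off one period: the rest is a copy, shifted by
`L`, of the word for `n - m`. -/
theorem outputs_periodic {L B m : ℕ} {f : ℕ → List ℕ} (hm : 0 < m)
    (hL : ((List.range m).flatMap f).length = L) (hf : ∀ j, f (m + j) = f j)
    (hσ : σ.Outputs ((List.range m).flatMap f))
    (hper : ∀ j < B, σ.arr 1 (L + j) = σ.arr 1 j) (n : ℕ)
    (hn : ((List.range n).flatMap f).length ≤ B) : σ.Outputs ((List.range n).flatMap f) := by
  induction n using Nat.strong_induction_on with
  | _ n ih =>
    by_cases hmn : n ≤ m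
    · obtain ⟨d, rfl⟩ := Nat.exists_eq_add_of_le hmn
      rw [List.range_add, List.flatMap_append, outputs_append] at hσ
      exact hσ.1
    · obtain ⟨d, rfl⟩ := Nat.exists_eq_add_of_le (le_of_not_ge hmn)
      have hsplit : (List.range (m + d)).flatMap f =
          (List.range m).flatMap f ++ (List.range d).flatMap f := by
        rw [List.range_add, List.flatMap_append, List.flatMap_map]
        simp only [hf]
      rw [hsplit, List.length_append] at hn
      rw [hsplit, outputs_append]
      refine ⟨hσ, fun i hi => ?_⟩
      rw [hL, hper i (by omega)]
      exact ih d (by omega) (by omega) i hi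

/-! ### The main theorem -/

theorem length_block_le (p : I.graph.PathFromTo I.source I.sink) :
    (I.block p).length ≤ I.numVertices := by
  have := p.2.2.length_le_card
  simpa [block] using this

theorem ncard_mod_eq {n m : ℕ} (j : Fin m) (φ : Fin n → Fin m) (hφ : ∀ i, (φ i : ℕ) = i % m) :
    {i | φ i = j}.ncard = n / m ∨ {i | φ i = j}.ncard = n ⌈/⌉ m := by
  have hm : 0 < m := j.pos
  have h1 : {i | φ i = j}.ncard = n.count (· ≡ j [MOD m]) := by
    rw [Set.ncard_eq_toFinset_card', Set.toFinset_ofPred, Nat.count_eq_card_filter_range,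
      Finset.card_filter, Finset.card_filter,
      ← Fin.sum_univ_eq_sum_range (fun i => if i ≡ j [MOD m] then 1 else 0)]
    refine Finset.sum_congr rfl fun i _ => ?_
    simp only [Fin.ext_iff, hφ, Nat.ModEq, Nat.mod_eq_of_lt j.2]
  rw [h1, Nat.count_modEq_card _ hm, Nat.ceilDiv_eq_add_pred_div]
  split
  case isFalse => exact .inl rfl
  case isTrue h =>
    -- Here `j < n % m`, so `m` does not divide `n` and the ceiling is `n / m + 1`.
    refine .inr (Eq.symm ?_)
    have h2 := Nat.div_add_mod n m
    have h3 := Nat.mod_lt n hm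
    have h4 : n + m - 1 = (n % m - 1) + m * (n / m + 1) := by
      rw [Nat.mul_add, Nat.mul_one]
      omega
    rw [h4, Nat.add_mul_div_left _ _ hm, Nat.div_eq_of_lt (by omega), Nat.zero_add]

theorem run_mainCode (hσ : I.Ready σ) (h2 : ∀ j, σ.arr 2 j = 0) (h8 : σ.reg 8 = 0) :
    ∃ x : I.Profile, (mainCode.run σ).Outputs (I.encodeProfile x) ∧
      I.graph.IsEvenSpread I.source I.sink x := by
  obtain ⟨hflow, U, hU, hm⟩ := run_maxFlow hσ h2 h8
  have hr₁ : I.Ready (maxFlow.run σ) := hσ.run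
    (by simp [Code.regs, maxFlow, search, relax, tryLabel, walk, walkStep])
    (by simp [Code.arrs, maxFlow, search, relax, tryLabel, walk, walkStep])
  have hrun : mainCode.run σ = repeatOutput.run (extractPaths.run (maxFlow.run σ)) := rfl
  rw [hrun]
  set σ₁ := maxFlow.run σ
  set m := σ₁.reg 8 with hmdef
  have hmA : m ≤ I.numArcs := by
    have := Set.ncard_le_card (I.graph.outArcs U)
    rwa [Nat.card_fin, hm] at this
  have hm0 : 0 < m := by
    obtain ⟨p, hp⟩ := I.exists_path
    obtain ⟨a, -, ha⟩ := hp.1.exists_mem_outArcs hU.1 hU.2.1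
    rw [← hm]
    exact (Set.ncard_pos).2 ⟨a, ha⟩
  obtain ⟨Q, hdisj, hout, hpos⟩ := run_extractPaths hr₁ hflow rfl (by rw [size]; omega)
  have hr₂ : I.Ready (extractPaths.run σ₁) := hr₁.run
    (by simp [Code.regs, extractPaths, search, relax, tryLabel, walk, walkStep])
    (by simp [Code.arrs, extractPaths, search, relax, tryLabel, walk, walkStep])
  set σ₂ := extractPaths.run σ₁
  have hword : ((List.range m).flatMap fun j => I.block (Q (j % m))) =
      (List.range m).flatMap fun j => I.block (Q j) :=
    List.flatMap_congr fun j hj => by rw [Nat.mod_eq_of_lt (List.mem_range.1 hj)]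
  rw [← hword] at hout hpos
  have hL : 0 < σ₂.reg 6 := by
    obtain ⟨k, hk⟩ := Nat.exists_eq_add_of_le' hm0
    rw [hpos, hk, List.range_succ, List.flatMap_append]
    simp [block]
  obtain ⟨hkeep, hper⟩ := run_repeatOutput hL
  -- A block holds the length and at most `numVertices - 1` arcs, so the `size + 1` squared copied
  -- cells suffice for all players.
  have hlen : ((List.range I.numPlayers).flatMap fun j => I.block (Q (j % m))).length ≤
      σ₂.reg 0 * σ₂.reg 0 := by
    rw [List.length_flatMap]
    refine (List.sum_le_card_nsmul _ I.numVertices ?_).trans ?_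
    · intro k hk
      obtain ⟨j, -, rfl⟩ := List.mem_map.1 hk
      exact length_block_le _
    · rw [List.length_map, List.length_range, smul_eq_mul, hr₂.reg_zero, size]
      exact Nat.mul_le_mul (by omega) (by omega)
  refine ⟨fun i => Q (i % m), ?_, m, fun j => Q j, ⟨U, hU, hm⟩, fun j l hjl => ?_,
    fun i => ⟨i % m, Nat.mod_lt _ hm0⟩, fun i => rfl, fun j => ncard_mod_eq j _ fun _ => rfl⟩
  · have h1 : I.encodeProfile (fun i => Q (i % m)) =
        (List.range I.numPlayers).flatMap fun j => I.block (Q (j % m)) := by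
      rw [← List.map_coe_finRange_eq_range, List.flatMap_map]
      rfl
    rw [h1]
    refine outputs_periodic hm0 hpos.symm (fun j => by simp) (fun j hj => ?_) hper _ hlen
    rw [hkeep j (by rw [hpos]; exact hj)]
    exact hout j hj
  · rcases Nat.lt_or_gt_of_ne (fun h => hjl (Fin.ext h)) with h | h
    · exact hdisj j l h l.2
    · exact (hdisj l j h j.2).symm

end RoutingInstance

theorem mainTheorem11 :
    RAM.SolvableInPolyTime RoutingInstance.encode RoutingInstance.size
      RoutingInstance.encodeProfile
      (fun (I : RoutingInstance) (x : I.Profile) =>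
        (∀ (c : ℝ≥0 → ℝ≥0) (hc : Monotone c), IsStrongNash (I.game c hc).privateCost x) ∧
          I.graph.IsEvenSpread I.source I.sink x) := by
  refine ⟨RoutingInstance.mainProgram, Polynomial.C (RoutingInstance.boundExpr.size + 1) +
    RoutingInstance.mainCode.time.comp (Polynomial.X + 1), fun I => ?_⟩
  have hbound : RoutingInstance.boundExpr.eval (RAM.initial I.encode) = I.size + 1 := by
    simp [RoutingInstance.boundExpr, RAM.Expr.eval, RAM.initial, RoutingInstance.encode,
      RoutingInstance.size, add_assoc]
  have hexec := RAM.Exec.assign 0 RoutingInstance.boundExpr (RAM.initial I.encode)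
  rw [hbound] at hexec
  set σ := (RAM.initial I.encode).setReg 0 (I.size + 1) with hσ
  have hready : I.Ready σ := ⟨by simp [hσ], rfl⟩
  obtain ⟨x, hout, hx⟩ := RoutingInstance.run_mainCode hready (fun _ => rfl) rfl
  obtain ⟨k, hk, hkt⟩ := RAM.Code.exec_toProgram RoutingInstance.mainCode_wellFormed σ
  refine ⟨_, _, x, .seq hexec hk, ?_, hout,
    fun c hc => RoutingInstance.isStrongNash_of_isEvenSpread hx c hc, hx⟩
  rw [hready.reg_zero] at hkt
  simpa [Polynomial.eval_comp] using hkt
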